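/- Equip $[0,1]$ with the Euclidean distance, with the rational numbers in $[0,1]$, effectively numbered, as ideal points, and let $(B_n)_{n\in\mathbb N}$ be the induced effective enumeration of the open balls of $[0,1]$ with ideal centre and positive rational radius. Let $T:[0,1]\to[0,1]$ be a Borel measurable map and let $D\subseteq[0,1]$ be a set of Hausdorff dimension $\dim_H(D)<1$. Suppose that $T$ is computable on $[0,1]\setminus D$, i.e. there is a recursively enumerable set $E\subseteq\mathbb N^2$ such that, with $U_n=\bigcup_{i:(n,i)\in E}B_i$, one has $T^{-1}(B_n)\setminus D=U_n\setminus D$ for every $n$. Suppose that $\mu$ is a $T$-invariant Borel probability measure on $[0,1]$ which is absolutely continuous with respect to Lebesgue measure with (essentially) bounded density, and that it is the only $T$-invariant Borel probability measure with these properties (in particular, this holds if $\mu$ has bounded density and is the unique absolutely continuous $T$-invariant Borel probability measure). Then $\mu$ is computable: there is a recursive sequence $(\mu_n)_{n\in\mathbb N}$ of finite rational convex combinations of Dirac measures at rational points of $[0,1]$ such that, for every $n$, $$W_1(\mu_n,\mu)=\sup\Big\{\Big|\int f\,d\mu_n-\int f\,d\mu\Big| : f:[0,1]\to\mathbb R\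 \text{1-Lipschitz}\Big\}<2^{-n}.$$ -/

import Mathlib

open MeasureTheory Set
open scoped NNReal ENNReal unitInterval

noncomputable section

namespace CompMeas

/-! In what follows `s : ι → X` is the numbered dense set of ideal points of a metric space `X`.
Names of points range over a type `ι` with a primitive recursive coding by natural numbers. -/

/-- The open ball whose centre is the ideal point named `p.1` and whose radius is the positive
rational `(p.2.1 + 1) / (p.2.2 + 1)`; every positive rational occurs as a radius. -/
def idealBall {X ι : Type*} [PseudoMetricSpace X] (s : ι → X) (p : ι × ℕ × ℕ) : Set X :=
  Metric.ball (s p.1) (((p.2.1 : ℝ) + 1) / ((p.2.2 : ℝ) + 1))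

/-- The sets `U n` are recursively open, uniformly in `n`: there is a recursively enumerable set
`E` of pairs such that `U n` is the union of the ideal balls with a name `i` with `(n, i) ∈ E`. -/
def UniformlyRecOpen {X ι κ : Type*} [PseudoMetricSpace X] [Primcodable ι] [Primcodable κ]
    (s : ι → X) (U : κ → Set X) : Prop :=
  ∃ E : Set (κ × ι × ℕ × ℕ), REPred (fun z => z ∈ E) ∧
    ∀ n, U n = ⋃ i ∈ {i : ι × ℕ × ℕ | (n, i) ∈ E}, idealBall s i

/-- `T` is computable on `C`: the preimages of the ideal balls `B n` coincide on `C` with sets that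
are recursively open uniformly in `n`. -/
def IsComputableOn {X Y ι κ : Type*} [PseudoMetricSpace X] [PseudoMetricSpace Y]
    [Primcodable ι] [Primcodable κ] (s : ι → X) (t : κ → Y) (T : X → Y) (C : Set X) : Prop :=
  ∃ U : κ × ℕ × ℕ → Set X, UniformlyRecOpen s U ∧
    ∀ n, T ⁻¹' idealBall t n ∩ C = U n ∩ C

/-- The Wasserstein–Kantorovich distance
`W₁(μ, ν) = sup {|∫ f dμ - ∫ f dν| : f : X → ℝ 1-Lipschitz}` of two probability measures on a
bounded space. -/
def W1 {X : Type*} [PseudoMetricSpace X] [BoundedSpace X] [MeasurableSpace X]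
    (μ ν : Measure X) : ℝ :=
  ⨆ f : {f : X → ℝ // LipschitzWith 1 f}, |∫ x, f.1 x ∂μ - ∫ x, f.1 x ∂ν|

/-- The total weight of a finite list of points with natural number weights. -/
def totalWeight {ι : Type*} (L : List (ι × ℕ)) : ℕ := (L.map Prod.snd).sum

/-- The measure `(∑ w)⁻¹ ∑ w • δ_{s i}`, with sums over the entries `(i, w)` of the list `L`. The
lists of positive total weight name exactly the finite rational convex combinations of Dirac
measures at ideal points. -/
def idealMeasure {X ι : Type*} [MeasurableSpace X] (s : ι → X) (L : List (ι × ℕ)) : Measure X :=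
  (totalWeight L : ℝ≥0∞)⁻¹ • (L.map fun p => (p.2 : ℝ≥0∞) • Measure.dirac (s p.1)).sum

/-- A probability measure is computable if it is the limit of a recursive sequence of ideal
measures converging exponentially fast to it in the distance `W1`. -/
def IsComputableMeasure {X ι : Type*} [PseudoMetricSpace X] [BoundedSpace X] [MeasurableSpace X]
    [Primcodable ι] (s : ι → X) (μ : Measure X) : Prop :=
  ∃ φ : ℕ → List (ι × ℕ), Computable φ ∧
    ∀ n, 0 < totalWeight (φ n) ∧ W1 (idealMeasure s (φ n)) μ < (1 / 2 : ℝ) ^ n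

/-- The ideal points of `[0,1]`: the pair `(a, b)` names `min (a / (b + 1)) 1`, so that the ideal
points are exactly the rational numbers in `[0,1]`. -/
def ratPoint (p : ℕ × ℕ) : I :=
  Set.projIcc (0 : ℝ) 1 zero_le_one ((p.1 : ℝ) / ((p.2 : ℝ) + 1))

/-- `μ` is absolutely continuous with respect to Lebesgue measure on `[0,1]` and its density is
(essentially) bounded. -/
def HasBoundedDensity (μ : Measure I) : Prop :=
  μ ≪ volume ∧ ∃ K : ℝ≥0, ∀ᵐ x ∂(volume : Measure I), μ.rnDeriv volume x ≤ K

/-- `μ` is a `T`-invariant Borel probability measure on `[0,1]`, absolutely continuous with respect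
to Lebesgue measure, with bounded density. -/
def IsBoundedACIM (T : I → I) (μ : Measure I) : Prop :=
  IsProbabilityMeasure μ ∧ MeasurePreserving T μ μ ∧ HasBoundedDensity μ

end CompMeas

end

/-! A set of Hausdorff dimension less than one is Lebesgue null, so measures dominated by `K •
volume` do not see `D`, and for them the preimage of a ball under `T` may be replaced by a
recursively open set. The probability measures dominated by `K • volume` correspond to the
normalized `K`-Lipschitz distribution functions, which form a compact set. Among them, invariance
amounts to `ν (T ⁻¹' B) ≤ ν B` for balls `B` of dyadic radius around 0 and 1
(`measurePreserving_of_endBall`): the two endpoints bound the image measure of initial segments from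
above and from below. The preimage is exhausted by finite unions of dyadic cells that appear at
finite stages, so every violated inequality is noticed after finitely many steps. The invariant
measures with density at most `K` are thus an effectively closed subset of an effectively compact
space. By uniqueness this subset is a single point, and such a point is computable.

The algorithm searches for a level `r` and an admissible sample to which all admissible samples of
that level are close. The result is correct because the rounded distribution function of `μ` is
itself admissible (`IsRounding.admissible`, `Certifies.W1_lt`). The search terminates
(`exists_certifies`): otherwise each high level would have an admissible sample far from `μ`, and a
limit of these (`exists_limit_measure`) would be an invariant measure with density at most `K`
different from `μ`. -/

namespace CompMeas

/-! ### Recursive enumerations, coding of finite functions, bounded quantifiers and search -/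

section Computability

variable {α β : Type*} [Primcodable α] [Primcodable β]

/-- Dovetailing: the time `t` encodes a step bound and an input, and the input is output if the
machine halts on it within that bound. Step-bounded evaluation is primitive recursive. -/
theorem _root_.REPred.exists_primrec_enum {p : α → Prop} (hp : REPred p) :
    ∃ f : ℕ → Option α, Primrec f ∧ ∀ a, p a ↔ ∃ t, f t = some a := by
  obtain ⟨c, hc⟩ := Nat.Partrec.Code.exists_code.1 hp
  refine ⟨fun t => (c.evaln t.unpair.1 t.unpair.2).bind fun _ => Encodable.decode t.unpair.2,
    ?_, fun a => ⟨fun ha => ?_, ?_⟩⟩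
  · refine Primrec.option_bind ?_ ?_
    · exact Nat.Partrec.Code.primrec_evaln.comp
        (((Primrec.fst.comp Primrec.unpair).pair (Primrec.const c)).pair
          (Primrec.snd.comp Primrec.unpair))
    · exact Primrec.decode.comp (Primrec.snd.comp (Primrec.unpair.comp Primrec.fst))
  · have h0 : Encodable.encode () ∈ c.eval (Encodable.encode a) := by
      rw [hc]
      simp only [Encodable.encodek, Part.coe_some, Part.bind_some, Part.mem_map_iff]
      exact ⟨(), Part.mem_assert_iff.2 ⟨ha, Part.mem_some _⟩, trivial⟩
    obtain ⟨k, hk⟩ := Nat.Partrec.Code.evaln_complete.1 h0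
    refine ⟨Nat.pair k (Encodable.encode a), ?_⟩
    rw [Option.mem_def] at hk
    simp [hk]
  · rintro ⟨t, ht⟩
    obtain ⟨x, hx, hx'⟩ := Option.bind_eq_some_iff.1 ht
    have h1 := Nat.Partrec.Code.evaln_sound hx
    simp only [hc, hx', Part.coe_some, Part.bind_some, Part.mem_map_iff] at h1
    obtain ⟨y, hy, -⟩ := h1
    exact (Part.mem_assert_iff.1 hy).1

/-- The flag `ok` marks the times at which the value of the total function `g` counts, so the empty
predicate is allowed. -/
theorem _root_.REPred.exists_primrec_enum' [Inhabited α] {p : α → Prop} (hp : REPred p) :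
    ∃ (ok : ℕ → Bool) (g : ℕ → α), Primrec ok ∧ Primrec g ∧ ∀ a, p a ↔ ∃ t, ok t ∧ g t = a := by
  obtain ⟨f, hf, h⟩ := hp.exists_primrec_enum
  refine ⟨fun t => (f t).isSome, fun t => (f t).getD default, Primrec.option_isSome.comp hf,
    Primrec.option_getD_default.comp hf, fun a => (h a).trans (exists_congr fun t => ?_)⟩
  cases hft : f t <;> simp [hft]

/-- The `k`-th digit of `c` in base `b`. -/
def digit (b c k : ℕ) : ℕ := c / b ^ k % b

/-- Coding samples by numbers below an explicit bound turns quantification over all samples of one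
level into a bounded quantifier. -/
theorem exists_digit_eq (b n : ℕ) (g : ℕ → ℕ) (hg : ∀ k < n, g k < b) :
    ∃ c < b ^ n, ∀ k < n, digit b c k = g k := by
  induction n with
  | zero => exact ⟨0, by simp, by simp⟩
  | succ n ih =>
    obtain ⟨c, hc, h⟩ := ih fun k hk => hg k (hk.trans n.lt_succ_self)
    have hb := hg n n.lt_succ_self
    refine ⟨c + b ^ n * g n, ?_, fun k hk => ?_⟩
    · calc c + b ^ n * g n < b ^ n * (g n + 1) := by rw [mul_add_one]; omega
        _ ≤ b ^ n * b := Nat.mul_le_mul_left _ hb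
        _ = b ^ (n + 1) := (pow_succ _ _).symm
    · have hb0 : 0 < b := by omega
      rcases (Nat.lt_succ_iff.1 hk).lt_or_eq with hkn | rfl
      · rw [← h k hkn, digit, digit]
        obtain ⟨m, rfl⟩ := Nat.exists_eq_add_of_lt hkn
        rw [show b ^ (k + m + 1) * g (k + m + 1) = b ^ k * (b * (b ^ m * g (k + m + 1))) by ring,
          Nat.add_mul_div_left _ _ (by positivity), Nat.add_mul_mod_self_left]
      · rw [digit, Nat.add_mul_div_left _ _ (by positivity), Nat.div_eq_of_lt hc, zero_add,
          Nat.mod_eq_of_lt hb]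

theorem _root_.Primrec.finset_sum {n : α → ℕ} {f : α → ℕ → ℕ} (hn : Primrec n)
    (hf : Primrec fun p : α × ℕ => f p.1 p.2) :
    Primrec fun a => ∑ j ∈ Finset.range (n a), f a j := by
  have h := Primrec.nat_rec' (h := fun a (p : ℕ × ℕ) => p.2 + f a p.1) hn (Primrec.const 0)
    (Primrec.nat_add.comp (Primrec.snd.comp Primrec.snd)
      (hf.comp (Primrec.fst.pair (Primrec.fst.comp Primrec.snd))))
  refine h.of_eq fun a => ?_
  induction n a with
  | zero => rfl
  | succ m ih => rw [Finset.sum_range_succ, ← ih]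

theorem _root_.PrimrecPred.forall_lt_of {n : α → ℕ} {R : α → ℕ → Prop} (hn : Primrec n)
    (hR : PrimrecPred fun p : α × ℕ => R p.1 p.2) : PrimrecPred fun a => ∀ x < n a, R a x := by
  have h : PrimrecRel fun (x : ℕ) (a : α) => R a x := hR.comp (Primrec.snd.pair Primrec.fst)
  exact (h.forall_mem_list.comp (Primrec.list_range.comp hn) Primrec.id).of_eq fun a => by simp

theorem _root_.PrimrecPred.exists_lt_of {n : α → ℕ} {R : α → ℕ → Prop} (hn : Primrec n)
    (hR : PrimrecPred fun p : α × ℕ => R p.1 p.2) : PrimrecPred fun a => ∃ x < n a, R a x := by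
  have h : PrimrecRel fun (x : ℕ) (a : α) => R a x := hR.comp (Primrec.snd.pair Primrec.fst)
  exact (h.exists_mem_list.comp (Primrec.list_range.comp hn) Primrec.id).of_eq fun a => by simp

variable {f g h : α → ℕ}

theorem _root_.Primrec.natAdd (hf : Primrec f) (hg : Primrec g) : Primrec fun a => f a + g a :=
  Primrec.nat_add.comp hf hg

theorem _root_.Primrec.natSub (hf : Primrec f) (hg : Primrec g) : Primrec fun a => f a - g a :=
  Primrec.nat_sub.comp hf hg

theorem _root_.Primrec.natMul (hf : Primrec f) (hg : Primrec g) : Primrec fun a => f a * g a :=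
  Primrec.nat_mul.comp hf hg

theorem _root_.Primrec.natMin (hf : Primrec f) (hg : Primrec g) :
    Primrec fun a => min (f a) (g a) :=
  Primrec.nat_min.comp hf hg

theorem _root_.Primrec.natPow (hf : Primrec f) (hg : Primrec g) : Primrec fun a => f a ^ g a :=
  (Primrec₂.unpaired'.1 Nat.Primrec.pow).comp hf hg

theorem _root_.Primrec.digit (hf : Primrec f) (hg : Primrec g) (hh : Primrec h) :
    Primrec fun a => digit (f a) (g a) (h a) :=
  Primrec.nat_mod.comp (Primrec.nat_div.comp hg (Primrec.natPow hf hh)) hf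

theorem _root_.Primrec.natLe (hf : Primrec f) (hg : Primrec g) :
    PrimrecPred fun a => f a ≤ g a :=
  Primrec.nat_le.comp hf hg

theorem _root_.Primrec.natLt (hf : Primrec f) (hg : Primrec g) :
    PrimrecPred fun a => f a < g a :=
  Primrec.nat_lt.comp hf hg

theorem _root_.PrimrecPred.eq {f g : α → β} (hf : Primrec f) (hg : Primrec g) :
    PrimrecPred fun a => f a = g a :=
  Primrec.eq.comp hf hg

/-- A search among the values of a primitive recursive predicate defines a computable function. -/
theorem exists_computable_of_primrecPred {R : ℕ → ℕ → Prop}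
    (hR : PrimrecPred fun p : ℕ × ℕ => R p.1 p.2) (hex : ∀ n, ∃ w, R n w) :
    ∃ F : ℕ → ℕ, Computable F ∧ ∀ n, R n (F n) := by
  classical
  refine ⟨fun n => Nat.find (hex n), ?_, fun n => Nat.find_spec (hex n)⟩
  have h1 : Computable₂ fun n w => decide (R n w) := hR.decide.to_comp
  refine (Partrec.rfind h1.partrec₂).of_eq_tot fun n => ?_
  rw [Nat.mem_rfind]
  refine ⟨by simpa using Nat.find_spec (hex n), fun hm => ?_⟩
  simpa using Nat.find_min (hex n) hm

end Computability

end CompMeas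

namespace CompMeas

/-! ### The finite test

Distribution functions are sampled at the multiples of `2 ^ (-r)` and rounded to multiples of
`(resolution r)⁻¹`. A sample is admissible if it passes finitely many tests for invariance. -/

/-- Names of ideal balls of `[0,1]`. -/
abbrev BallName := (ℕ × ℕ) × ℕ × ℕ

/-- The point `x / 2 ^ b` lies in the ideal ball named `p`. -/
def DyadicMem (b x : ℕ) (p : BallName) : Prop :=
  x * (p.1.2 + 1) * (p.2.2 + 1) < min p.1.1 (p.1.2 + 1) * 2 ^ b * (p.2.2 + 1) +
      (p.2.1 + 1) * 2 ^ b * (p.1.2 + 1) ∧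
    min p.1.1 (p.1.2 + 1) * 2 ^ b * (p.2.2 + 1) < x * (p.1.2 + 1) * (p.2.2 + 1) +
      (p.2.1 + 1) * 2 ^ b * (p.1.2 + 1)

/-- The `i`-th cell of side `2 ^ (-b)` is contained in one of the balls that `(ok, g)` lists under
the name `τ` before stage `b`. -/
def GoodCell (ok : ℕ → Bool) (g : ℕ → BallName × BallName) (τ : BallName) (b i : ℕ) : Prop :=
  ∃ t < b, ok t = true ∧ (g t).1 = τ ∧ DyadicMem b i (g t).2 ∧ DyadicMem b (i + 1) (g t).2

/-- The name of the ball of radius `(k + 1) / 2 ^ b` around the endpoint `side` of `[0,1]`. -/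
def endBall (side b k : ℕ) : BallName := ((side, 0), (k, 2 ^ b - 1))

/-- The lower endpoint of `endBall side b k`, in units of `2 ^ (-b)`. -/
def endLower (side b k : ℕ) : ℕ := side * (2 ^ b - (k + 1))

/-- The upper endpoint of `endBall side b k`, in units of `2 ^ (-b)`. -/
def endUpper (side b k : ℕ) : ℕ := k + 1 + side * (2 ^ b - (k + 1))

/-- The number of units of mass at level `r`. -/
def resolution (r : ℕ) : ℕ := 2 * (2 ^ r * 2 ^ r)

open Classical in
/-- The sum of `G` over the left (`e = 0`) or right (`e = 1`) endpoints of the good cells of side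
`2 ^ (-b)`. -/
noncomputable def goodSum (ok : ℕ → Bool) (g : ℕ → BallName × BallName) (τ : BallName) (b r e : ℕ)
    (G : ℕ → ℕ) : ℕ :=
  ∑ i ∈ Finset.range (2 ^ b), if GoodCell ok g τ b i then G ((i + e) * 2 ^ (r - b)) else 0

/-- `G` is, up to rounding errors, the sample at level `r` of a distribution function that has
Lipschitz constant `K` and passes the tests for invariance of scale less than `r`. -/
def Admissible (ok : ℕ → Bool) (g : ℕ → BallName × BallName) (K r : ℕ) (G : ℕ → ℕ) : Prop :=
  G 0 = 0 ∧ G (2 ^ r) = resolution r ∧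
  (∀ j < 2 ^ r, G j ≤ G (j + 1) ∧ G (j + 1) ≤ G j + (2 * K * 2 ^ r + 1)) ∧
  ∀ side < 2, ∀ b < r, ∀ b₀ < r, ∀ k < 2 ^ b₀,
    goodSum ok g (endBall side b₀ k) b r 1 G + G (endLower side b₀ k * 2 ^ (r - b₀)) ≤
      goodSum ok g (endBall side b₀ k) b r 0 G + G (endUpper side b₀ k * 2 ^ (r - b₀)) +
        (2 ^ r + 1)

/-- The samples `G` and `G'` differ by at most `2 ^ (-2 a - 1)` at the multiples of `2 ^ (-a)`. -/
def SampleClose (a r : ℕ) (G G' : ℕ → ℕ) : Prop :=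
  ∀ i < 2 ^ a + 1,
    G (i * 2 ^ (r - a)) * (2 * (2 ^ a * 2 ^ a)) ≤
        G' (i * 2 ^ (r - a)) * (2 * (2 ^ a * 2 ^ a)) + resolution r ∧
      G' (i * 2 ^ (r - a)) * (2 * (2 ^ a * 2 ^ a)) ≤
        G (i * 2 ^ (r - a)) * (2 * (2 ^ a * 2 ^ a)) + resolution r

/-- The sample at level `r` coded by `c`. -/
def sample (r c : ℕ) : ℕ → ℕ := digit (resolution r + 1) c

/-- The sample at level `r` coded by `c` is admissible, and all admissible samples are close to
it. -/
def Certifies (ok : ℕ → Bool) (g : ℕ → BallName × BallName) (K a r c : ℕ) : Prop :=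
  a ≤ r ∧ Admissible ok g K r (sample r c) ∧
    ∀ c' < (resolution r + 1) ^ (2 ^ r + 1), ¬ Admissible ok g K r (sample r c') ∨
      SampleClose a r (sample r c') (sample r c)

/-- The ideal measure with atoms at the multiples of `2 ^ (-a)` given by a sample. -/
def sampleList (a r : ℕ) (G : ℕ → ℕ) : List ((ℕ × ℕ) × ℕ) :=
  (List.range (2 ^ a)).map fun i =>
    ((i, 2 ^ a - 1), G ((i + 1) * 2 ^ (r - a)) - G (i * 2 ^ (r - a)))

/-! ### Primitive recursiveness of the finite test -/

section Computability

variable {α : Type*} [Primcodable α] {ok : ℕ → Bool} {g : ℕ → BallName × BallName}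

theorem _root_.Primrec.prodFst {β γ : Type*} [Primcodable β] [Primcodable γ] {f : α → β × γ}
    (hf : Primrec f) : Primrec fun a => (f a).1 :=
  Primrec.fst.comp hf

theorem _root_.Primrec.prodSnd {β γ : Type*} [Primcodable β] [Primcodable γ] {f : α → β × γ}
    (hf : Primrec f) : Primrec fun a => (f a).2 :=
  Primrec.snd.comp hf

theorem _root_.Primrec.dyadicMem {b x : α → ℕ} {p : α → BallName} (hb : Primrec b)
    (hx : Primrec x) (hp : Primrec p) : PrimrecPred fun a => DyadicMem (b a) (x a) (p a) := by
  have h2 : Primrec fun a => 2 ^ b a := (Primrec.const 2).natPow hb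
  have h3 : Primrec fun a => (p a).1.2 + 1 := hp.prodFst.prodSnd.natAdd (Primrec.const 1)
  have h4 : Primrec fun a => (p a).2.2 + 1 := hp.prodSnd.prodSnd.natAdd (Primrec.const 1)
  have h5 : Primrec fun a => (p a).2.1 + 1 := hp.prodSnd.prodFst.natAdd (Primrec.const 1)
  have h6 := (hx.natMul h3).natMul h4
  have h7 := ((hp.prodFst.prodFst.natMin h3).natMul h2).natMul h4
  have h8 := (h5.natMul h2).natMul h3
  exact (h6.natLt (h7.natAdd h8)).and (h7.natLt (h6.natAdd h8))

theorem _root_.Primrec.goodCell (hok : Primrec ok) (hg : Primrec g) {τ : α → BallName}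
    {b i : α → ℕ} (hτ : Primrec τ) (hb : Primrec b) (hi : Primrec i) :
    PrimrecPred fun a => GoodCell ok g (τ a) (b a) (i a) := by
  have hgt : Primrec fun p : α × ℕ => g p.2 := hg.comp Primrec.snd
  have hb' := hb.comp (Primrec.fst (α := α) (β := ℕ))
  have hi' := hi.comp (Primrec.fst (α := α) (β := ℕ))
  refine PrimrecPred.exists_lt_of hb ?_
  exact (PrimrecPred.eq (hok.comp Primrec.snd) (Primrec.const true)).and
    ((PrimrecPred.eq hgt.prodFst (hτ.comp Primrec.fst)).and
      ((Primrec.dyadicMem hb' hi' hgt.prodSnd).and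
        (Primrec.dyadicMem hb' (hi'.natAdd (Primrec.const 1)) hgt.prodSnd)))

theorem _root_.Primrec.resolution {r : α → ℕ} (hr : Primrec r) :
    Primrec fun a => resolution (r a) :=
  have h := (Primrec.const 2).natPow hr
  (Primrec.const 2).natMul (h.natMul h)

theorem _root_.Primrec.sample {r c k : α → ℕ} (hr : Primrec r) (hc : Primrec c)
    (hk : Primrec k) : Primrec fun a => sample (r a) (c a) (k a) :=
  (hr.resolution.natAdd (Primrec.const 1)).digit hc hk

theorem _root_.Primrec.goodSum (hok : Primrec ok) (hg : Primrec g) {τ : α → BallName}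
    {b r e c : α → ℕ} (hτ : Primrec τ) (hb : Primrec b) (hr : Primrec r) (he : Primrec e)
    (hc : Primrec c) :
    Primrec fun a => goodSum ok g (τ a) (b a) (r a) (e a) (sample (r a) (c a)) := by
  classical
  refine Primrec.finset_sum ((Primrec.const 2).natPow hb) ?_
  refine Primrec.ite (Primrec.goodCell hok hg (hτ.comp Primrec.fst) (hb.comp Primrec.fst)
    Primrec.snd) ?_ (Primrec.const 0)
  exact (hr.comp Primrec.fst).sample (hc.comp Primrec.fst)
    ((Primrec.snd.natAdd (he.comp Primrec.fst)).natMul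
      ((Primrec.const 2).natPow ((hr.natSub hb).comp Primrec.fst)))

theorem _root_.Primrec.admissible (hok : Primrec ok) (hg : Primrec g) (K : ℕ) {r c : α → ℕ}
    (hr : Primrec r) (hc : Primrec c) :
    PrimrecPred fun a => Admissible ok g K (r a) (sample (r a) (c a)) := by
  have h2r := (Primrec.const 2).natPow hr
  refine (PrimrecPred.eq (hr.sample hc (Primrec.const 0)) (Primrec.const 0)).and
    ((PrimrecPred.eq (hr.sample hc h2r) hr.resolution).and (PrimrecPred.and ?_ ?_))
  · refine PrimrecPred.forall_lt_of h2r ?_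
    have h1 := (hr.comp Primrec.fst).sample (hc.comp Primrec.fst) (Primrec.snd (α := α) (β := ℕ))
    have h2 := (hr.comp Primrec.fst).sample (hc.comp Primrec.fst)
      ((Primrec.snd (α := α) (β := ℕ)).natAdd (Primrec.const 1))
    exact (h1.natLe h2).and (h2.natLe (h1.natAdd
      (((Primrec.const (2 * K)).natMul (h2r.comp Primrec.fst)).natAdd (Primrec.const 1))))
  · refine PrimrecPred.forall_lt_of (Primrec.const 2) (PrimrecPred.forall_lt_of
      (hr.comp Primrec.fst) (PrimrecPred.forall_lt_of (hr.comp (Primrec.fst.comp Primrec.fst))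
        (PrimrecPred.forall_lt_of ((Primrec.const 2).natPow Primrec.snd) ?_)))
    have hr' : Primrec fun p : (((α × ℕ) × ℕ) × ℕ) × ℕ => r p.1.1.1.1 :=
      hr.comp Primrec.id.prodFst.prodFst.prodFst.prodFst
    have hc' : Primrec fun p : (((α × ℕ) × ℕ) × ℕ) × ℕ => c p.1.1.1.1 :=
      hc.comp Primrec.id.prodFst.prodFst.prodFst.prodFst
    have hs : Primrec fun p : (((α × ℕ) × ℕ) × ℕ) × ℕ => p.1.1.1.2 :=
      Primrec.id.prodFst.prodFst.prodFst.prodSnd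
    have hb : Primrec fun p : (((α × ℕ) × ℕ) × ℕ) × ℕ => p.1.1.2 :=
      Primrec.id.prodFst.prodFst.prodSnd
    have hb₀ : Primrec fun p : (((α × ℕ) × ℕ) × ℕ) × ℕ => p.1.2 := Primrec.id.prodFst.prodSnd
    have hk : Primrec fun p : (((α × ℕ) × ℕ) × ℕ) × ℕ => p.2 := Primrec.id.prodSnd
    have h2 := (Primrec.const 2).natPow hb₀
    have hk1 := hk.natAdd (Primrec.const 1)
    have hτ : Primrec fun p : (((α × ℕ) × ℕ) × ℕ) × ℕ => endBall p.1.1.1.2 p.1.2 p.2 :=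
      (hs.pair (Primrec.const 0)).pair (hk.pair (h2.natSub (Primrec.const 1)))
    have hlo : Primrec fun p : (((α × ℕ) × ℕ) × ℕ) × ℕ => endLower p.1.1.1.2 p.1.2 p.2 :=
      hs.natMul (h2.natSub hk1)
    have hup : Primrec fun p : (((α × ℕ) × ℕ) × ℕ) × ℕ => endUpper p.1.1.1.2 p.1.2 p.2 :=
      hk1.natAdd (hs.natMul (h2.natSub hk1))
    have h3 := (Primrec.const 2).natPow (hr'.natSub hb₀)
    exact ((Primrec.goodSum hok hg hτ hb hr' (Primrec.const 1) hc').natAdd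
      (hr'.sample hc' (hlo.natMul h3))).natLe
      (((Primrec.goodSum hok hg hτ hb hr' (Primrec.const 0) hc').natAdd
        (hr'.sample hc' (hup.natMul h3))).natAdd
        (((Primrec.const 2).natPow hr').natAdd (Primrec.const 1)))

theorem _root_.Primrec.sampleClose {a r c c' : α → ℕ} (ha : Primrec a) (hr : Primrec r)
    (hc : Primrec c) (hc' : Primrec c') :
    PrimrecPred fun x => SampleClose (a x) (r x) (sample (r x) (c x)) (sample (r x) (c' x)) := by
  have h2a := (Primrec.const 2).natPow ha
  refine PrimrecPred.forall_lt_of (h2a.natAdd (Primrec.const 1)) ?_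
  have hi := (Primrec.snd (α := α) (β := ℕ)).natMul
    (((Primrec.const 2).natPow (hr.natSub ha)).comp Primrec.fst)
  have h1 := (hr.comp Primrec.fst).sample (hc.comp Primrec.fst) hi
  have h2 := (hr.comp Primrec.fst).sample (hc'.comp Primrec.fst) hi
  have h3 := ((Primrec.const 2).natMul (h2a.natMul h2a)).comp (Primrec.fst (α := α) (β := ℕ))
  have h4 := hr.resolution.comp (Primrec.fst (α := α) (β := ℕ))
  exact ((h1.natMul h3).natLe ((h2.natMul h3).natAdd h4)).and
    ((h2.natMul h3).natLe ((h1.natMul h3).natAdd h4))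

theorem _root_.Primrec.certifies (hok : Primrec ok) (hg : Primrec g) (K : ℕ) {a r c : α → ℕ}
    (ha : Primrec a) (hr : Primrec r) (hc : Primrec c) :
    PrimrecPred fun x => Certifies ok g K (a x) (r x) (c x) := by
  refine (ha.natLe hr).and ((Primrec.admissible hok hg K hr hc).and ?_)
  refine PrimrecPred.forall_lt_of ((hr.resolution.natAdd (Primrec.const 1)).natPow
    (((Primrec.const 2).natPow hr).natAdd (Primrec.const 1))) ?_
  exact (Primrec.admissible hok hg K (hr.comp Primrec.fst) Primrec.snd).not.or
    ((ha.comp Primrec.fst).sampleClose (hr.comp Primrec.fst) Primrec.snd (hc.comp Primrec.fst))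

theorem _root_.Primrec.sampleList {a r c : α → ℕ} (ha : Primrec a) (hr : Primrec r)
    (hc : Primrec c) : Primrec fun x => sampleList (a x) (r x) (sample (r x) (c x)) := by
  have h2a := (Primrec.const 2).natPow ha
  refine Primrec.list_map (Primrec.list_range.comp h2a) ?_
  have h := ((Primrec.const 2).natPow (hr.natSub ha)).comp (Primrec.fst (α := α) (β := ℕ))
  have hr' := hr.comp (Primrec.fst (α := α) (β := ℕ))
  have hc' := hc.comp (Primrec.fst (α := α) (β := ℕ))
  exact (Primrec.snd.pair ((h2a.comp Primrec.fst).natSub (Primrec.const 1))).pair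
    ((hr'.sample hc' ((Primrec.snd.natAdd (Primrec.const 1)).natMul h)).natSub
      (hr'.sample hc' (Primrec.snd.natMul h)))

end Computability

/-- A measure is computable if its approximations by samples can be certified. -/
theorem isComputableMeasure_of_certifies {ok : ℕ → Bool} {g : ℕ → BallName × BallName}
    (hok : Primrec ok) (hg : Primrec g) (K : ℕ) {μ : Measure I}
    (hsound : ∀ n r c, Certifies ok g K (n + 2) r c →
      0 < totalWeight (sampleList (n + 2) r (sample r c)) ∧
        W1 (idealMeasure ratPoint (sampleList (n + 2) r (sample r c))) μ < (1 / 2 : ℝ) ^ n)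
    (hcomplete : ∀ n, ∃ r c, Certifies ok g K (n + 2) r c) :
    IsComputableMeasure ratPoint μ := by
  have h2 : Primrec fun p : ℕ × ℕ => p.2.unpair.1 := (Primrec.unpair.comp Primrec.snd).prodFst
  have h3 : Primrec fun p : ℕ × ℕ => p.2.unpair.2 := (Primrec.unpair.comp Primrec.snd).prodSnd
  have h1 : Primrec fun p : ℕ × ℕ => p.1 + 2 := Primrec.fst.natAdd (Primrec.const 2)
  obtain ⟨F, hF, h⟩ := exists_computable_of_primrecPred
    (R := fun n w => Certifies ok g K (n + 2) w.unpair.1 w.unpair.2)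
    (Primrec.certifies hok hg K h1 h2 h3) fun n => by
      obtain ⟨r, c, hrc⟩ := hcomplete n
      refine ⟨Nat.pair r c, ?_⟩
      rw [Nat.unpair_pair]
      exact hrc
  have h4 : Computable fun p : ℕ × ℕ =>
      sampleList (p.1 + 2) p.2.unpair.1 (sample p.2.unpair.1 p.2.unpair.2) :=
    (h1.sampleList h2 h3).to_comp
  have h5 : Computable fun n => (n, F n) := Computable.id.pair hF
  have h6 := h4.comp h5
  exact ⟨_, h6, fun n => hsound n _ _ (h n)⟩

end CompMeas

namespace CompMeas

open Filter Topology

/-! ### Measures with bounded density and their distribution functions -/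

/-- Domination by `K • volume` is the form of the density bound that passes to Lipschitz estimates
for distribution functions. An integer `K` can be built into the finite test. -/
theorem hasBoundedDensity_iff_exists_le {ν : Measure I} [IsFiniteMeasure ν] :
    HasBoundedDensity ν ↔ ∃ K : ℕ, ν ≤ (K : ℝ≥0∞) • (volume : Measure I) := by
  constructor
  · rintro ⟨hac, K, hK⟩
    obtain ⟨n, hn⟩ := exists_nat_ge K
    refine ⟨n, ?_⟩
    rw [← Measure.withDensity_rnDeriv_eq ν volume hac, ← withDensity_const]
    refine withDensity_mono (hK.mono fun x hx => hx.trans ?_)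
    change (K : ℝ≥0∞) ≤ (n : ℝ≥0∞)
    exact_mod_cast hn
  · rintro ⟨K, hK⟩
    refine ⟨Measure.absolutelyContinuous_of_le_smul hK, K, ?_⟩
    refine ae_le_of_forall_setLIntegral_le_of_sigmaFinite (Measure.measurable_rnDeriv _ _)
      fun s hs _ => ?_
    calc ∫⁻ x in s, ν.rnDeriv volume x ≤ ν s := Measure.setLIntegral_rnDeriv_le s
      _ ≤ ((K : ℝ≥0∞) • (volume : Measure I)) s := hK s
      _ = ∫⁻ _ in s, ((K : ℝ≥0) : ℝ≥0∞) := by simp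

/-- Lebesgue measure on the line is the one-dimensional Hausdorff measure, which vanishes on sets of
smaller dimension. -/
theorem volume_eq_zero_of_dimH_lt_one {D : Set I} (hD : dimH D < 1) :
    (volume : Measure I) D = 0 := by
  rw [unitInterval.volume_apply, ← hausdorffMeasure_real]
  have h : dimH (Subtype.val '' D) < ((1 : ℝ≥0) : ℝ≥0∞) := by
    rw [(isometry_subtype_coe (s := I)).dimH_image]
    exact_mod_cast hD
  simpa using hausdorffMeasure_of_dimH_lt h

/-- The distribution function of a measure on `[0,1]`. -/
noncomputable def cdf (ν : Measure I) (x : ℝ) : ℝ := ν.real {y : I | (y : ℝ) < x}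

section cdf

variable {ν : Measure I}

theorem measurableSet_coe_lt (x : ℝ) : MeasurableSet {y : I | (y : ℝ) < x} :=
  measurable_subtype_coe measurableSet_Iio

theorem cdf_nonneg (ν : Measure I) (x : ℝ) : 0 ≤ cdf ν x := measureReal_nonneg

theorem cdf_zero (ν : Measure I) : cdf ν 0 = 0 := by
  have h : {y : I | (y : ℝ) < 0} = ∅ := by
    ext y
    simpa using y.2.1
  rw [cdf, h, measureReal_empty]

theorem volume_coe_mem_Ico_le (a b : ℝ) :
    (volume : Measure I) {y : I | (y : ℝ) ∈ Ico a b} ≤ ENNReal.ofReal (b - a) := by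
  rw [unitInterval.volume_apply, ← Real.volume_Ico]
  exact measure_mono (image_subset_iff.2 fun y hy => hy)

theorem real_coe_mem_Ico [IsFiniteMeasure ν] {a b : ℝ} (hab : a ≤ b) :
    ν.real {y : I | (y : ℝ) ∈ Ico a b} = cdf ν b - cdf ν a := by
  have h : {y : I | (y : ℝ) ∈ Ico a b} = {y : I | (y : ℝ) < b} \ {y : I | (y : ℝ) < a} := by
    ext y
    simp [and_comm]
  have hsub : {y : I | (y : ℝ) < a} ⊆ {y : I | (y : ℝ) < b} := fun y hy => lt_of_lt_of_le hy hab
  rw [h, measureReal_sdiff hsub (measurableSet_coe_lt a)]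
  rfl

theorem cdf_mono [IsFiniteMeasure ν] : Monotone (cdf ν) := fun _ _ hab =>
  measureReal_mono fun _ hy => lt_of_lt_of_le hy hab

theorem cdf_sub_le [IsFiniteMeasure ν] {K : ℕ} (hK : ν ≤ (K : ℝ≥0∞) • (volume : Measure I))
    {a b : ℝ} (hab : a ≤ b) : cdf ν b - cdf ν a ≤ K * (b - a) := by
  rw [← real_coe_mem_Ico hab]
  refine ENNReal.toReal_le_of_le_ofReal (by have := sub_nonneg.2 hab; positivity) ?_
  calc ν {y : I | (y : ℝ) ∈ Ico a b} ≤ K * volume {y : I | (y : ℝ) ∈ Ico a b} := hK _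
    _ ≤ K * ENNReal.ofReal (b - a) := by gcongr; exact volume_coe_mem_Ico_le a b
    _ = ENNReal.ofReal (K * (b - a)) := by
      rw [ENNReal.ofReal_mul (by positivity), ENNReal.ofReal_natCast]

theorem measure_singleton_eq_zero {K : ℕ} (hK : ν ≤ (K : ℝ≥0∞) • (volume : Measure I)) (x : I) :
    ν {x} = 0 :=
  Measure.absolutelyContinuous_of_le_smul hK (by
    rw [unitInterval.volume_apply, image_singleton, Real.volume_singleton])

theorem cdf_one [IsProbabilityMeasure ν] {K : ℕ}
    (hK : ν ≤ (K : ℝ≥0∞) • (volume : Measure I)) : cdf ν 1 = 1 := by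
  have h : {y : I | (y : ℝ) < 1} = {1}ᶜ := by
    ext y
    rw [mem_ofPred_eq, mem_compl_iff, mem_singleton_iff, unitInterval.coe_lt_one,
      unitInterval.lt_one_iff_ne_one]
  rw [cdf, h, probReal_compl_eq_one_sub (measurableSet_singleton _), measureReal_def,
    measure_singleton_eq_zero hK]
  simp

theorem cdf_le_one [IsProbabilityMeasure ν] (x : ℝ) : cdf ν x ≤ 1 := measureReal_le_one

theorem real_Iic_eq_cdf [IsFiniteMeasure ν] {K : ℕ}
    (hK : ν ≤ (K : ℝ≥0∞) • (volume : Measure I)) (x : I) : ν.real (Iic x) = cdf ν x := by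
  refine measureReal_congr ?_
  have : NullSingletonClass ν := ⟨measure_singleton_eq_zero hK⟩
  have h : {y : I | (y : ℝ) < x} = Iio x := rfl
  rw [h]
  exact Iio_ae_eq_Iic.symm

/-- Every normalized Lipschitz distribution function on `[0,1]` belongs to a probability measure
with bounded density. -/
theorem exists_measure_cdf_eq {K : ℕ} {F : ℝ → ℝ} (hmono : Monotone F)
    (hlip : ∀ x y, x ≤ y → F y - F x ≤ K * (y - x)) (h0 : F 0 = 0) (h1 : F 1 = 1) :
    ∃ ν : Measure I, IsProbabilityMeasure ν ∧ ν ≤ (K : ℝ≥0∞) • (volume : Measure I) ∧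
      ∀ x ∈ Icc (0 : ℝ) 1, cdf ν x = F x := by
  have hcont : Continuous F := by
    refine (LipschitzWith.of_le_add_mul (K : ℝ≥0) fun x y => ?_).continuous
    rcases le_total x y with h | h
    · have := hmono h
      have : 0 ≤ ((K : ℝ≥0) : ℝ) * dist x y := by positivity
      linarith
    · have := hlip y x h
      rw [Real.dist_eq, abs_of_nonneg (sub_nonneg.2 h)]
      simpa using by linarith
  let f : StieltjesFunction ℝ := ⟨F, hmono, fun x => hcont.continuousWithinAt⟩
  -- The Lipschitz bound makes `K * x - F x` monotone as well. The Stieltjes measures of `F` and of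
  -- this complement add up to `K` times Lebesgue measure, which gives the domination.
  let g : StieltjesFunction ℝ := ⟨fun x => K * x - F x, fun x y hxy => by
    have := hlip x y hxy
    simp only
    linarith, fun x => (by fun_prop : Continuous fun x => K * x - F x).continuousWithinAt⟩
  have hfg : f + g = (K : ℝ≥0) • StieltjesFunction.id := by
    ext x
    change F x + (K * x - F x) = K * x
    ring
  have hfl : f.measure ≤ (K : ℝ≥0∞) • (volume : Measure ℝ) := by
    have h : (f + g).measure = ((K : ℝ≥0) • StieltjesFunction.id).measure := by rw [hfg]
    rw [StieltjesFunction.measure_add, StieltjesFunction.measure_smul,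
      ← Real.volume_eq_stieltjes_id] at h
    calc f.measure ≤ f.measure + g.measure := Measure.le_add_right le_rfl
      _ = (K : ℝ≥0) • (volume : Measure ℝ) := h
      _ = (K : ℝ≥0∞) • (volume : Measure ℝ) := by ext s hs; simp [ENNReal.smul_def]
  have hlim : ∀ x, Function.leftLim f x = F x := fun x =>
    ContinuousWithinAt.leftLim_eq (f := F) hcont.continuousWithinAt
  have hval : ∀ s : Set I, f.measure.comap Subtype.val s = f.measure (Subtype.val '' s) :=
    fun s => unitInterval.measurableEmbedding_coe.comap_apply _ _
  refine ⟨f.measure.comap Subtype.val, ⟨?_⟩, ?_, fun x hx => ?_⟩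
  · rw [hval, image_univ, Subtype.range_coe, StieltjesFunction.measure_Icc, hlim]
    change ENNReal.ofReal (F 1 - F 0) = 1
    simp [h0, h1]
  · intro s
    rw [hval]
    refine (hfl _).trans ?_
    simp [unitInterval.volume_apply]
  · have himg : Subtype.val '' {y : I | (y : ℝ) < x} = Ico 0 x := by
      ext y
      simp only [mem_image, mem_ofPred_eq, Subtype.exists, exists_and_left, exists_prop,
        exists_eq_right_right, mem_Ico]
      exact ⟨fun h => ⟨h.2.1, h.1⟩, fun h => ⟨h.2, h.1, (h.2.trans_le hx.2).le⟩⟩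
    rw [cdf, measureReal_def, hval, himg, StieltjesFunction.measure_Ico, hlim, hlim, h0, sub_zero,
      ENNReal.toReal_ofReal (h0 ▸ hmono hx.1)]

end cdf

end CompMeas

namespace CompMeas

open Filter Topology

/-! ### Invariant measures have admissible samples -/

theorem coe_ratPoint (p : ℕ × ℕ) :
    (ratPoint p : ℝ) = (min p.1 (p.2 + 1) : ℕ) / ((p.2 : ℝ) + 1) := by
  have h : (0 : ℝ) < (p.2 : ℝ) + 1 := by positivity
  rw [ratPoint, coe_projIcc, max_eq_right (le_min zero_le_one (by positivity)), Nat.cast_min,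
    ← min_div_div_right h.le, min_comm, Nat.cast_succ, div_self h.ne']

/-- Clearing the positive denominators makes membership of a dyadic point in an ideal ball a
decidable inequality between natural numbers. -/
theorem dyadicMem_iff (b x : ℕ) (p : BallName) :
    DyadicMem b x p ↔
      |(x : ℝ) / 2 ^ b - ratPoint p.1| < ((p.2.1 : ℝ) + 1) / ((p.2.2 : ℝ) + 1) := by
  rw [coe_ratPoint, DyadicMem]
  set m := min p.1.1 (p.1.2 + 1)
  have hV : (0 : ℝ) < (p.1.2 : ℝ) + 1 := by positivity
  have hW : (0 : ℝ) < (p.2.2 : ℝ) + 1 := by positivity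
  have hB : (0 : ℝ) < 2 ^ b := by positivity
  rw [abs_sub_lt_iff, sub_lt_iff_lt_add, sub_lt_iff_lt_add, ← Nat.cast_lt (α := ℝ),
    ← Nat.cast_lt (α := ℝ)]
  push_cast
  refine and_congr ?_ ?_
  · rw [div_add_div _ _ hW.ne' hV.ne', div_lt_div_iff₀ hB (by positivity)]
    refine iff_of_eq (congrArg₂ _ ?_ ?_) <;> ring
  · rw [div_add_div _ _ hW.ne' hB.ne', div_lt_div_iff₀ hV (by positivity)]
    rw [← mul_lt_mul_iff_left₀ hW]
    constructor <;> intro h <;> nlinarith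

/-- The union of the balls listed by `(ok, g)` under the name `τ`. -/
def enumOpen (ok : ℕ → Bool) (g : ℕ → BallName × BallName) (τ : BallName) : Set I :=
  {y | ∃ t, ok t = true ∧ (g t).1 = τ ∧ y ∈ idealBall ratPoint (g t).2}

variable {ok : ℕ → Bool} {g : ℕ → BallName × BallName} {τ : BallName} {ν : Measure I} {K : ℕ}

theorem mem_idealBall_iff (p : BallName) (y : I) :
    y ∈ idealBall ratPoint p ↔ |(y : ℝ) - ratPoint p.1| < ((p.2.1 : ℝ) + 1) / ((p.2.2 : ℝ) + 1) := by
  rw [idealBall, Metric.mem_ball, Subtype.dist_eq, Real.dist_eq]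

theorem measurableSet_idealBall (p : BallName) : MeasurableSet (idealBall ratPoint p) :=
  Metric.isOpen_ball.measurableSet

/-- The `i`-th cell of side `2 ^ (-b)`. -/
def cell (b i : ℕ) : Set I := {y : I | (y : ℝ) ∈ Ico ((i : ℝ) / 2 ^ b) (((i + 1 : ℕ) : ℝ) / 2 ^ b)}

theorem measurableSet_cell (b i : ℕ) : MeasurableSet (cell b i) :=
  measurable_subtype_coe measurableSet_Ico

theorem pairwiseDisjoint_cell (b : ℕ) (s : Set ℕ) : s.PairwiseDisjoint (cell b) := by
  have key : ∀ i j : ℕ, i < j → Disjoint (cell b i) (cell b j) := fun i j hij => by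
    rw [Set.disjoint_left]
    intro y hi hj
    have h : ((i + 1 : ℕ) : ℝ) / 2 ^ b ≤ (j : ℝ) / 2 ^ b := by
      gcongr
      exact hij
    exact absurd (hi.2.trans_le h) (not_lt.2 hj.1)
  intro i _ j _ hij
  rcases lt_or_gt_of_ne hij with h | h
  · exact key i j h
  · exact (key j i h).symm

theorem real_cell [IsFiniteMeasure ν] (b i : ℕ) :
    ν.real (cell b i) = cdf ν (((i + 1 : ℕ) : ℝ) / 2 ^ b) - cdf ν ((i : ℝ) / 2 ^ b) :=
  real_coe_mem_Ico (by gcongr; simp)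

/-- Balls of `[0,1]` are order convex, so it suffices to test the two endpoints of a cell. -/
theorem GoodCell.cell_subset {b i : ℕ} (h : GoodCell ok g τ b i) :
    cell b i ⊆ enumOpen ok g τ := by
  obtain ⟨t, -, hok, hg, h1, h2⟩ := h
  rw [dyadicMem_iff, abs_sub_lt_iff] at h1 h2
  refine fun y hy => ⟨t, hok, hg, ?_⟩
  rw [mem_idealBall_iff, abs_sub_lt_iff]
  obtain ⟨h3, h4⟩ := hy
  constructor <;> linarith

open Classical in
/-- The indices of the good cells of side `2 ^ (-b)`. -/
noncomputable def goodCells (ok : ℕ → Bool) (g : ℕ → BallName × BallName) (τ : BallName)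
    (b : ℕ) : Finset ℕ :=
  (Finset.range (2 ^ b)).filter (GoodCell ok g τ b)

theorem mem_goodCells {b i : ℕ} : i ∈ goodCells ok g τ b ↔ i < 2 ^ b ∧ GoodCell ok g τ b i := by
  classical
  simp [goodCells]

theorem goodSum_eq (b r e : ℕ) (G : ℕ → ℕ) :
    goodSum ok g τ b r e G = ∑ i ∈ goodCells ok g τ b, G ((i + e) * 2 ^ (r - b)) := by
  classical
  rw [goodSum, goodCells, Finset.sum_filter]

theorem real_biUnion_goodCells [IsFiniteMeasure ν] (b : ℕ) :
    ν.real (⋃ i ∈ goodCells ok g τ b, cell b i) =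
      ∑ i ∈ goodCells ok g τ b,
        (cdf ν (((i + 1 : ℕ) : ℝ) / 2 ^ b) - cdf ν ((i : ℝ) / 2 ^ b)) := by
  rw [measureReal_biUnion_finset (pairwiseDisjoint_cell b _) fun i _ => measurableSet_cell b i]
  exact Finset.sum_congr rfl fun i _ => real_cell b i

theorem biUnion_goodCells_subset (b : ℕ) :
    ⋃ i ∈ goodCells ok g τ b, cell b i ⊆ enumOpen ok g τ :=
  iUnion₂_subset fun _ hi => (mem_goodCells.1 hi).2.cell_subset

theorem coe_ratPoint_zero : (ratPoint (0, 0) : ℝ) = 0 := by simp [coe_ratPoint]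

theorem coe_ratPoint_one : (ratPoint (1, 0) : ℝ) = 1 := by simp [coe_ratPoint]

theorem endBall_radius (side b k : ℕ) :
    (((endBall side b k).2.1 : ℝ) + 1) / (((endBall side b k).2.2 : ℝ) + 1) =
      ((k + 1 : ℕ) : ℝ) / 2 ^ b := by
  have h : ((2 ^ b - 1 : ℕ) : ℝ) + 1 = 2 ^ b := by
    rw [Nat.cast_sub Nat.one_le_two_pow]
    simp
  simp only [endBall]
  rw [h, Nat.cast_succ]

theorem mem_endBall_zero (b k : ℕ) (y : I) :
    y ∈ idealBall ratPoint (endBall 0 b k) ↔ (y : ℝ) < ((k + 1 : ℕ) : ℝ) / 2 ^ b := by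
  rw [mem_idealBall_iff, endBall_radius]
  change |(y : ℝ) - ratPoint (0, 0)| < _ ↔ _
  rw [coe_ratPoint_zero, sub_zero, abs_of_nonneg y.2.1]

theorem mem_endBall_one (b k : ℕ) (y : I) :
    y ∈ idealBall ratPoint (endBall 1 b k) ↔ 1 - ((k + 1 : ℕ) : ℝ) / 2 ^ b < (y : ℝ) := by
  rw [mem_idealBall_iff, endBall_radius]
  change |(y : ℝ) - ratPoint (1, 0)| < _ ↔ _
  rw [coe_ratPoint_one, abs_sub_comm, abs_of_nonneg (sub_nonneg.2 y.2.2), sub_lt_comm]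

theorem coe_sub_div_two_pow {b k : ℕ} (hk : k ≤ 2 ^ b) :
    ((2 ^ b - k : ℕ) : ℝ) / 2 ^ b = 1 - (k : ℝ) / 2 ^ b := by
  rw [Nat.cast_sub hk, sub_div, Nat.cast_pow, Nat.cast_ofNat, div_self (by positivity)]

theorem real_endBall [IsProbabilityMeasure ν] (hK : ν ≤ (K : ℝ≥0∞) • (volume : Measure I))
    {side b k : ℕ} (hs : side < 2) (hk : k < 2 ^ b) :
    ν.real (idealBall ratPoint (endBall side b k)) =
      cdf ν ((endUpper side b k : ℝ) / 2 ^ b) - cdf ν ((endLower side b k : ℝ) / 2 ^ b) := by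
  interval_cases side
  · have h : idealBall ratPoint (endBall 0 b k) = {y : I | (y : ℝ) < ((k + 1 : ℕ) : ℝ) / 2 ^ b} :=
      Set.ext fun y => mem_endBall_zero b k y
    have h0 : endLower 0 b k = 0 := Nat.zero_mul _
    have h1 : endUpper 0 b k = k + 1 := by simp [endUpper]
    rw [h, h0, h1, Nat.cast_zero, zero_div, cdf_zero, sub_zero, cdf]
  · have h1 : endUpper 1 b k = 2 ^ b := by rw [endUpper]; omega
    have h2 : endLower 1 b k = 2 ^ b - (k + 1) := by rw [endLower]; omega
    have h3 : (k + 1 : ℕ) ≤ 2 ^ b := hk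
    have h4 : ((k + 1 : ℕ) : ℝ) / 2 ^ b ≤ 1 := by
      rw [div_le_one (by positivity)]
      exact_mod_cast h3
    let x : I := ⟨1 - ((k + 1 : ℕ) : ℝ) / 2 ^ b, sub_nonneg.2 h4, sub_le_self _ (by positivity)⟩
    have h : idealBall ratPoint (endBall 1 b k) = (Iic x)ᶜ := by
      ext y
      rw [mem_endBall_one, mem_compl_iff, mem_Iic, not_le]
      rfl
    rw [h, probReal_compl_eq_one_sub measurableSet_Iic, real_Iic_eq_cdf hK, h1, h2,
      coe_sub_div_two_pow h3, Nat.cast_pow, Nat.cast_ofNat, div_self (by positivity), cdf_one hK]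

theorem endUpper_le {side b k : ℕ} (hs : side < 2) (hk : k < 2 ^ b) : endUpper side b k ≤ 2 ^ b := by
  interval_cases side <;> rw [endUpper] <;> omega

theorem endLower_le {side b k : ℕ} (hs : side < 2) : endLower side b k ≤ 2 ^ b := by
  interval_cases side <;> simp [endLower]

theorem mul_two_pow_sub_le {b r i : ℕ} (hbr : b ≤ r) (hi : i ≤ 2 ^ b) :
    i * 2 ^ (r - b) ≤ 2 ^ r := by
  calc i * 2 ^ (r - b) ≤ 2 ^ b * 2 ^ (r - b) := Nat.mul_le_mul_right _ hi
    _ = 2 ^ r := by rw [← pow_add, Nat.add_sub_cancel' hbr]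

theorem coe_mul_two_pow_sub_div {b r : ℕ} (i : ℕ) (hbr : b ≤ r) :
    ((i * 2 ^ (r - b) : ℕ) : ℝ) / 2 ^ r = (i : ℝ) / 2 ^ b := by
  obtain ⟨d, rfl⟩ := Nat.exists_eq_add_of_le hbr
  rw [Nat.add_sub_cancel_left, pow_add]
  push_cast
  rw [mul_div_mul_right _ _ (by positivity)]

/-- For an invariant measure the mass of the good cells is at most that of the target ball. -/
theorem sum_goodCells_le {T : I → I} (hinv : MeasurePreserving T ν ν) [IsProbabilityMeasure ν]
    (hK : ν ≤ (K : ℝ≥0∞) • (volume : Measure I))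
    (hT : ∀ τ, T ⁻¹' idealBall ratPoint τ =ᵐ[volume] enumOpen ok g τ) {side b₀ k : ℕ}
    (hs : side < 2) (hk : k < 2 ^ b₀) (b : ℕ) :
    ∑ i ∈ goodCells ok g (endBall side b₀ k) b,
        (cdf ν (((i + 1 : ℕ) : ℝ) / 2 ^ b) - cdf ν ((i : ℝ) / 2 ^ b)) ≤
      cdf ν ((endUpper side b₀ k : ℝ) / 2 ^ b₀) - cdf ν ((endLower side b₀ k : ℝ) / 2 ^ b₀) := by
  have hac : ν ≪ volume := Measure.absolutelyContinuous_of_le_smul hK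
  rw [← real_biUnion_goodCells, ← real_endBall hK hs hk,
    ← hinv.measureReal_preimage (measurableSet_idealBall _).nullMeasurableSet,
    measureReal_congr (hac.ae_eq (hT _))]
  exact measureReal_mono (biUnion_goodCells_subset b)

/-- The sample `G` of level `r` arises from the distribution function of `ν` by rounding down. -/
def IsRounding (ν : Measure I) (r : ℕ) (G : ℕ → ℕ) : Prop :=
  ∀ k ≤ 2 ^ r, G k = ⌊(resolution r : ℝ) * cdf ν ((k : ℝ) / 2 ^ r)⌋₊

theorem IsRounding.le {r k : ℕ} {G : ℕ → ℕ} (hG : IsRounding ν r G) (hk : k ≤ 2 ^ r) :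
    (G k : ℝ) ≤ (resolution r : ℝ) * cdf ν ((k : ℝ) / 2 ^ r) := by
  rw [hG k hk]
  exact Nat.floor_le (mul_nonneg (Nat.cast_nonneg _) (cdf_nonneg ν _))

theorem IsRounding.lt {r k : ℕ} {G : ℕ → ℕ} (hG : IsRounding ν r G) (hk : k ≤ 2 ^ r) :
    (resolution r : ℝ) * cdf ν ((k : ℝ) / 2 ^ r) < G k + 1 := by
  rw [hG k hk]
  exact Nat.lt_floor_add_one _

theorem exists_sample_isRounding [IsProbabilityMeasure ν] (r : ℕ) :
    ∃ c < (resolution r + 1) ^ (2 ^ r + 1), IsRounding ν r (sample r c) := by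
  obtain ⟨c, hc, h⟩ := exists_digit_eq (resolution r + 1) (2 ^ r + 1)
    (fun k => ⌊(resolution r : ℝ) * cdf ν ((k : ℝ) / 2 ^ r)⌋₊) fun k _ =>
      Nat.lt_succ_of_le (Nat.floor_le_of_le (mul_le_of_le_one_right (Nat.cast_nonneg _)
        (cdf_le_one _)))
  exact ⟨c, hc, fun k hk => h k (Nat.lt_succ_of_le hk)⟩

theorem coe_resolution (r : ℕ) : (resolution r : ℝ) = 2 * (2 ^ r * 2 ^ r) := by
  simp [resolution]

theorem resolution_pos (r : ℕ) : (0 : ℝ) < resolution r := by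
  rw [coe_resolution]
  positivity

theorem IsRounding.admissible {T : I → I} (hinv : MeasurePreserving T ν ν)
    [IsProbabilityMeasure ν] (hK : ν ≤ (K : ℝ≥0∞) • (volume : Measure I))
    (hT : ∀ τ, T ⁻¹' idealBall ratPoint τ =ᵐ[volume] enumOpen ok g τ) {r : ℕ} {G : ℕ → ℕ}
    (hG : IsRounding ν r G) : Admissible ok g K r G := by
  have hM := resolution_pos r
  refine ⟨?_, ?_, fun j hj => ⟨?_, ?_⟩, fun side hs b hb b₀ hb₀ k hk => ?_⟩
  · rw [hG 0 (Nat.zero_le _)]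
    simp [cdf_zero]
  · rw [hG _ le_rfl, Nat.cast_pow, Nat.cast_ofNat, div_self (by positivity), cdf_one hK, mul_one,
      Nat.floor_natCast]
  · rw [hG j hj.le, hG (j + 1) hj]
    refine Nat.floor_le_floor (mul_le_mul_of_nonneg_left (cdf_mono ?_) hM.le)
    gcongr
    simp
  · refine Nat.lt_succ_iff.1 ?_
    rw [← Nat.cast_lt (α := ℝ)]
    have h1 := hG.le (k := j + 1) hj
    have h2 := hG.lt hj.le
    -- An increment of at most `K / 2 ^ r` is `2 * K * 2 ^ r` units of mass; the additional 1 in the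
    -- test absorbs the rounding.
    have h3 : cdf ν (((j + 1 : ℕ) : ℝ) / 2 ^ r) - cdf ν ((j : ℝ) / 2 ^ r) ≤ K * (1 / 2 ^ r) := by
      refine (cdf_sub_le hK (by gcongr; simp)).trans_eq ?_
      push_cast
      ring
    have h4 := mul_le_mul_of_nonneg_left h3 hM.le
    have h5 : (resolution r : ℝ) * (K * (1 / 2 ^ r)) = 2 * K * 2 ^ r := by
      rw [coe_resolution]
      field_simp
    push_cast
    rw [mul_sub, h5] at h4
    push_cast at h1 h4
    linarith
  · set τ := endBall side b₀ k
    have hidx : ∀ i ∈ goodCells ok g τ b, i + 1 ≤ 2 ^ b := fun i hi => (mem_goodCells.1 hi).1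
    have h1 : (goodSum ok g τ b r 1 G : ℝ) ≤ resolution r * ∑ i ∈ goodCells ok g τ b,
        cdf ν (((i + 1 : ℕ) : ℝ) / 2 ^ b) := by
      rw [goodSum_eq, Nat.cast_sum, Finset.mul_sum]
      refine Finset.sum_le_sum fun i hi => ?_
      have := hG.le (mul_two_pow_sub_le hb.le (hidx i hi))
      rwa [coe_mul_two_pow_sub_div _ hb.le] at this
    -- Rounding down loses less than one unit at each left endpoint, and there are at most `2 ^ b ≤
    -- 2 ^ r` good cells. The remaining 1 in the tolerance `2 ^ r + 1` pays for the rounding at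
    -- `endUpper`.
    have h2 : resolution r * ∑ i ∈ goodCells ok g τ b, cdf ν ((i : ℝ) / 2 ^ b) ≤
        (goodSum ok g τ b r 0 G : ℝ) + 2 ^ r := by
      have hcard : ((goodCells ok g τ b).card : ℝ) ≤ 2 ^ r := by
        have h : (goodCells ok g τ b).card ≤ 2 ^ b := by
          classical
          exact (Finset.card_filter_le _ _).trans_eq (Finset.card_range _)
        exact_mod_cast h.trans (Nat.pow_le_pow_right two_pos hb.le)
      have : resolution r * ∑ i ∈ goodCells ok g τ b, cdf ν ((i : ℝ) / 2 ^ b) ≤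
          ∑ i ∈ goodCells ok g τ b, ((G ((i + 0) * 2 ^ (r - b)) : ℝ) + 1) := by
        rw [Finset.mul_sum]
        refine Finset.sum_le_sum fun i hi => ?_
        have := hG.lt (mul_two_pow_sub_le hb.le ((Nat.le_succ i).trans (hidx i hi)))
        rw [coe_mul_two_pow_sub_div _ hb.le] at this
        exact this.le
      rw [Finset.sum_add_distrib, Finset.sum_const, nsmul_eq_mul, mul_one] at this
      rw [goodSum_eq, Nat.cast_sum]
      linarith
    have h3 := hG.le (mul_two_pow_sub_le hb₀.le (endLower_le (b := b₀) (k := k) hs))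
    have h4 := hG.lt (mul_two_pow_sub_le hb₀.le (endUpper_le hs hk))
    rw [coe_mul_two_pow_sub_div _ hb₀.le] at h3 h4
    have h5 := mul_le_mul_of_nonneg_left (sum_goodCells_le hinv hK hT hs hk b) hM.le
    rw [Finset.sum_sub_distrib, mul_sub, mul_sub] at h5
    rw [← Nat.cast_le (α := ℝ)]
    push_cast
    push_cast at h1 h5
    linarith

end CompMeas

namespace CompMeas

open Filter Topology

/-! ### The Kantorovich distance to a sample -/

theorem sum_map_list_range {M : Type*} [AddCommMonoid M] (n : ℕ) (f : ℕ → M) :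
    ((List.range n).map f).sum = ∑ i ∈ Finset.range n, f i := by
  induction n with
  | zero => simp
  | succ n ih => rw [List.range_succ, List.map_append, List.sum_append, ih, Finset.sum_range_succ]; simp

theorem le_of_forall_lt_le_succ {G : ℕ → ℕ} {n i j : ℕ} (hG : ∀ k < n, G k ≤ G (k + 1))
    (hij : i ≤ j) (hj : j ≤ n) : G i ≤ G j := by
  induction j, hij using Nat.le_induction with
  | base => exact le_rfl
  | succ j _ ih => exact (ih (Nat.le_of_succ_le hj)).trans (hG j hj)

theorem coe_ratPoint_two_pow {a i : ℕ} (hi : i ≤ 2 ^ a) :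
    (ratPoint (i, 2 ^ a - 1) : ℝ) = (i : ℝ) / 2 ^ a := by
  have h : ((2 ^ a - 1 : ℕ) : ℝ) + 1 = 2 ^ a := by
    rw [Nat.cast_sub Nat.one_le_two_pow]
    simp
  rw [coe_ratPoint]
  simp only
  rw [h, Nat.sub_add_cancel Nat.one_le_two_pow, min_eq_left hi]

theorem exists_mem_cell (a : ℕ) {y : I} (hy : y ≠ 1) : ∃ i < 2 ^ a, y ∈ cell a i := by
  have hB : (0 : ℝ) < 2 ^ a := by positivity
  have hy1 : (y : ℝ) < 1 := unitInterval.coe_lt_one.2 (unitInterval.lt_one_iff_ne_one.2 hy)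
  have h0 : (0 : ℝ) ≤ y * 2 ^ a := mul_nonneg y.2.1 hB.le
  refine ⟨⌊(y : ℝ) * 2 ^ a⌋₊, ?_, ?_, ?_⟩
  · rw [Nat.floor_lt h0]
    push_cast
    nlinarith
  · rw [div_le_iff₀ hB]
    exact Nat.floor_le h0
  · rw [lt_div_iff₀ hB]
    push_cast
    exact Nat.lt_floor_add_one _

theorem integrable_of_lipschitzWith {f : I → ℝ} {C : ℝ≥0} (hf : LipschitzWith C f) (ν : Measure I)
    [IsFiniteMeasure ν] : Integrable f ν :=
  hf.continuous.integrable_of_hasCompactSupport (HasCompactSupport.of_compactSpace f)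

/-- Riemann sums of Lipschitz functions on the cells of side `2 ^ (-a)`. -/
theorem abs_integral_sub_sum_cell_le {ν : Measure I} [IsProbabilityMeasure ν] {K : ℕ}
    (hK : ν ≤ (K : ℝ≥0∞) • (volume : Measure I)) {f : I → ℝ} (hf : LipschitzWith 1 f) (a : ℕ) :
    |∫ y, f y ∂ν - ∑ i ∈ Finset.range (2 ^ a), ν.real (cell a i) * f (ratPoint (i, 2 ^ a - 1))| ≤
      1 / 2 ^ a := by
  set p : ℕ → I := fun i => ratPoint (i, 2 ^ a - 1)
  have hint : ∀ i ∈ Finset.range (2 ^ a),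
      Integrable ((cell a i).indicator fun _ => f (p i)) ν := fun i _ =>
    (integrable_const _).indicator (measurableSet_cell a i)
  have hsum : ∑ i ∈ Finset.range (2 ^ a), ν.real (cell a i) * f (p i) =
      ∫ y, ∑ i ∈ Finset.range (2 ^ a), (cell a i).indicator (fun _ => f (p i)) y ∂ν := by
    rw [integral_finsetSum _ hint]
    refine Finset.sum_congr rfl fun i _ => ?_
    rw [integral_indicator_const _ (measurableSet_cell a i), smul_eq_mul]
  rw [hsum, ← integral_sub (integrable_of_lipschitzWith hf ν) (integrable_finsetSum _ hint),
    ← Real.norm_eq_abs]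
  -- The cells are half-open, so the point 1 lies in none of them.
  have hae : ∀ᵐ y ∂ν, y ≠ 1 := by
    rw [ae_iff]
    simpa using measure_singleton_eq_zero hK 1
  refine (norm_integral_le_of_norm_le_const (C := 1 / 2 ^ a) (hae.mono fun y hy => ?_)).trans_eq
    (by simp)
  obtain ⟨i, hi, hyi⟩ := exists_mem_cell a hy
  rw [Finset.sum_eq_single i, indicator_of_mem hyi, ← dist_eq_norm]
  · refine (hf.dist_le_mul _ _).trans ?_
    rw [NNReal.coe_one, one_mul, Subtype.dist_eq, coe_ratPoint_two_pow hi.le, Real.dist_eq,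
      abs_of_nonneg (sub_nonneg.2 hyi.1)]
    have := hyi.2
    push_cast at this
    rw [add_div] at this
    linarith
  · intro j _ hji
    exact indicator_of_notMem (fun hyj => Set.disjoint_left.1
      (pairwiseDisjoint_cell a univ (mem_univ j) (mem_univ i) hji) hyj hyi) _
  · intro h
    exact absurd (Finset.mem_range.2 hi) h

section sampleList

variable {a r : ℕ} {G : ℕ → ℕ}

theorem totalWeight_sampleList (har : a ≤ r) (h0 : G 0 = 0) (h1 : G (2 ^ r) = resolution r)
    (hG : ∀ k < 2 ^ r, G k ≤ G (k + 1)) : totalWeight (sampleList a r G) = resolution r := by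
  have key : ∀ n ≤ 2 ^ a, ∑ i ∈ Finset.range n, (G ((i + 1) * 2 ^ (r - a)) - G (i * 2 ^ (r - a))) =
      G (n * 2 ^ (r - a)) := by
    intro n hn
    induction n with
    | zero => simp [h0]
    | succ n ih =>
      rw [Finset.sum_range_succ, ih (Nat.le_of_succ_le hn)]
      exact Nat.add_sub_of_le (le_of_forall_lt_le_succ hG
        (Nat.mul_le_mul_right _ (Nat.le_succ n)) (mul_two_pow_sub_le har hn))
  rw [totalWeight, sampleList, List.map_map, ← h1]
  refine (sum_map_list_range _ _).trans ((key _ le_rfl).trans ?_)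
  rw [← pow_add, Nat.add_sub_cancel' har]

theorem integral_idealMeasure_sampleList (hw : totalWeight (sampleList a r G) = resolution r)
    {f : I → ℝ} (hf : LipschitzWith 1 f) :
    ∫ y, f y ∂(idealMeasure ratPoint (sampleList a r G)) =
      ∑ i ∈ Finset.range (2 ^ a),
        ((G ((i + 1) * 2 ^ (r - a)) - G (i * 2 ^ (r - a)) : ℕ) : ℝ) / resolution r *
          f (ratPoint (i, 2 ^ a - 1)) := by
  rw [idealMeasure, hw, sampleList, List.map_map, sum_map_list_range, integral_smul_measure,
    integral_finsetSum_measure, ENNReal.toReal_inv, ENNReal.toReal_natCast, smul_eq_mul,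
    Finset.mul_sum]
  · refine Finset.sum_congr rfl fun i _ => ?_
    simp only [Function.comp_apply]
    rw [integral_smul_measure, integral_dirac, ENNReal.toReal_natCast, smul_eq_mul]
    ring
  · intro i _
    simp only [Function.comp_apply]
    exact (integrable_of_lipschitzWith hf _).smul_measure (ENNReal.natCast_ne_top _)

/-- Moving the mass of each cell to its left endpoint costs at most the side `1 / 2 ^ a`. The weight
of a cell is a difference of two sampled values, hence wrong by at most `2 * δ`, and there are `2 ^
a` cells. -/
theorem W1_sampleList_le {ν : Measure I} [IsProbabilityMeasure ν] {K : ℕ}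
    (hK : ν ≤ (K : ℝ≥0∞) • (volume : Measure I)) (har : a ≤ r) (h0 : G 0 = 0)
    (h1 : G (2 ^ r) = resolution r) (hG : ∀ k < 2 ^ r, G k ≤ G (k + 1)) {δ : ℝ}
    (hδ : ∀ i ≤ 2 ^ a, |(G (i * 2 ^ (r - a)) : ℝ) / resolution r - cdf ν ((i : ℝ) / 2 ^ a)| ≤ δ) :
    W1 (idealMeasure ratPoint (sampleList a r G)) ν ≤ 1 / 2 ^ a + 2 ^ a * (2 * δ) := by
  have hM := resolution_pos r
  have hw := totalWeight_sampleList har h0 h1 hG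
  have : Nonempty {f : I → ℝ // LipschitzWith 1 f} :=
    ⟨⟨fun _ => 0, (LipschitzWith.const 0).weaken zero_le_one⟩⟩
  refine ciSup_le fun ⟨f, hf⟩ => ?_
  set w : ℕ → ℝ := fun i =>
    ((G ((i + 1) * 2 ^ (r - a)) - G (i * 2 ^ (r - a)) : ℕ) : ℝ) / resolution r
  set p : ℕ → I := fun i => ratPoint (i, 2 ^ a - 1)
  have hwi : ∀ i < 2 ^ a, w i = (G ((i + 1) * 2 ^ (r - a)) : ℝ) / resolution r -
      (G (i * 2 ^ (r - a)) : ℝ) / resolution r := fun i hi => by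
    rw [← sub_div, ← Nat.cast_sub (le_of_forall_lt_le_succ hG
      (Nat.mul_le_mul_right _ (Nat.le_succ i)) (mul_two_pow_sub_le har hi))]
  have hsum1 : ∑ i ∈ Finset.range (2 ^ a), w i = 1 := by
    rw [← Finset.sum_div, ← Nat.cast_sum, div_eq_one_iff_eq hM.ne', ← hw, totalWeight,
      sampleList, List.map_map, ← sum_map_list_range]
    rfl
  have hcell : ∀ i, ν.real (cell a i) =
      cdf ν (((i + 1 : ℕ) : ℝ) / 2 ^ a) - cdf ν ((i : ℝ) / 2 ^ a) := real_cell a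
  have hsum2 : ∑ i ∈ Finset.range (2 ^ a), ν.real (cell a i) = 1 := by
    rw [Finset.sum_congr rfl fun i _ => hcell i,
      Finset.sum_range_sub fun i : ℕ => cdf ν ((i : ℝ) / 2 ^ a)]
    rw [Nat.cast_pow, Nat.cast_ofNat, div_self (by positivity), cdf_one hK, Nat.cast_zero,
      zero_div, cdf_zero, sub_zero]
  have hterm : ∀ i ∈ Finset.range (2 ^ a),
      |(w i - ν.real (cell a i)) * (f (p i) - f (p 0))| ≤ 2 * δ := fun i hi => by
    have hi' := Finset.mem_range.1 hi
    have h2 := abs_le.1 (hδ i hi'.le)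
    have h3 := abs_le.1 (hδ (i + 1) hi')
    have h4 : |w i - ν.real (cell a i)| ≤ 2 * δ := by
      rw [hwi i hi', hcell i, abs_le]
      constructor <;> linarith
    have h5 : |f (p i) - f (p 0)| ≤ 1 := by
      rw [← Real.dist_eq]
      refine (hf.dist_le_mul _ _).trans ?_
      rw [NNReal.coe_one, one_mul, Subtype.dist_eq, Real.dist_eq, abs_le]
      constructor <;> linarith [(p i).2.1, (p i).2.2, (p 0).2.1, (p 0).2.2]
    rw [abs_mul]
    exact (mul_le_of_le_one_right (abs_nonneg _) h5).trans h4
  have hR := abs_integral_sub_sum_cell_le hK hf a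
  -- Both families of weights have sum 1, so `f` may be normalized to vanish at `p 0`; it is then
  -- bounded by 1.
  have hdiff : ∑ i ∈ Finset.range (2 ^ a), w i * f (p i) -
      ∑ i ∈ Finset.range (2 ^ a), ν.real (cell a i) * f (p i) =
      ∑ i ∈ Finset.range (2 ^ a), (w i - ν.real (cell a i)) * (f (p i) - f (p 0)) := by
    simp only [mul_sub, sub_mul, Finset.sum_sub_distrib, ← Finset.sum_mul, hsum1, hsum2]
    ring
  have hS : |∑ i ∈ Finset.range (2 ^ a), w i * f (p i) -
      ∑ i ∈ Finset.range (2 ^ a), ν.real (cell a i) * f (p i)| ≤ 2 ^ a * (2 * δ) := by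
    rw [hdiff]
    refine (Finset.abs_sum_le_sum_abs _ _).trans ((Finset.sum_le_sum hterm).trans_eq ?_)
    simp
  rw [integral_idealMeasure_sampleList hw hf]
  rw [abs_le] at hR hS ⊢
  constructor <;> linarith [hR.1, hR.2, hS.1, hS.2]

end sampleList

/-- Certified samples approximate the invariant measures with density bounded by `K`. -/
theorem Certifies.W1_lt {ok : ℕ → Bool} {g : ℕ → BallName × BallName} {ν : Measure I} {K : ℕ}
    {T : I → I} (hinv : MeasurePreserving T ν ν)
    [IsProbabilityMeasure ν] (hK : ν ≤ (K : ℝ≥0∞) • (volume : Measure I))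
    (hT : ∀ τ, T ⁻¹' idealBall ratPoint τ =ᵐ[volume] enumOpen ok g τ) {n r c : ℕ}
    (h : Certifies ok g K (n + 2) r c) :
    0 < totalWeight (sampleList (n + 2) r (sample r c)) ∧
      W1 (idealMeasure ratPoint (sampleList (n + 2) r (sample r c))) ν < (1 / 2 : ℝ) ^ n := by
  obtain ⟨har, ⟨h0, h1, hG, -⟩, hall⟩ := h
  have hG' := fun k hk => (hG k hk).1
  have hM := resolution_pos r
  refine ⟨by rw [totalWeight_sampleList har h0 h1 hG']; exact_mod_cast hM, ?_⟩
  obtain ⟨c', hc', hr⟩ := exists_sample_isRounding (ν := ν) r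
  -- The rounding of the true distribution function is among the samples against which the
  -- certificate was checked.
  have hclose := (hall c' hc').resolve_left (not_not.2 (hr.admissible hinv hK hT))
  set A : ℝ := 2 ^ (n + 2) with hA
  have hA0 : 0 < A := by positivity
  have hMA : 2 * (A * A) ≤ resolution r := by
    have : A ≤ 2 ^ r := pow_le_pow_right₀ one_le_two har
    rw [coe_resolution]
    gcongr
  -- Half of `1 / (A * A)` comes from `SampleClose`; the other half covers the rounding error of one
  -- unit, since `2 * (A * A) ≤ resolution r`.
  refine (W1_sampleList_le hK har h0 h1 hG' (δ := 1 / (A * A)) fun i hi => ?_).trans_lt ?_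
  · have hi' := mul_two_pow_sub_le har hi
    have h2 := hr.le hi'
    have h3 := hr.lt hi'
    rw [coe_mul_two_pow_sub_div _ har] at h2 h3
    obtain ⟨h4, h5⟩ := hclose i (Nat.lt_succ_of_le hi)
    rw [← Nat.cast_le (α := ℝ)] at h4 h5
    push_cast at h4 h5
    rw [← hA] at h4 h5 ⊢
    have h6 : (resolution r : ℝ) / (A * A) ≥ resolution r / (2 * (A * A)) + 1 := by
      have e : (resolution r : ℝ) / (A * A) =
          resolution r / (2 * (A * A)) + resolution r / (2 * (A * A)) := by
        field_simp
        ring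
      have : 1 ≤ (resolution r : ℝ) / (2 * (A * A)) := by rwa [one_le_div (by positivity)]
      linarith
    have h7 : (sample r c' (i * 2 ^ (r - (n + 2))) : ℝ) ≤
        sample r c (i * 2 ^ (r - (n + 2))) + resolution r / (2 * (A * A)) := by
      rw [← sub_le_iff_le_add', le_div_iff₀ (by positivity)]
      linarith
    have h8 : (sample r c (i * 2 ^ (r - (n + 2))) : ℝ) ≤
        sample r c' (i * 2 ^ (r - (n + 2))) + resolution r / (2 * (A * A)) := by
      rw [← sub_le_iff_le_add', le_div_iff₀ (by positivity)]
      linarith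
    have h9 : (resolution r : ℝ) * (1 / (A * A)) = resolution r / (A * A) := by ring
    rw [← mul_le_mul_iff_right₀ hM, ← abs_of_pos hM, ← abs_mul, abs_of_pos hM, mul_sub,
      mul_div_cancel₀ _ hM.ne', h9, abs_le]
    constructor <;> linarith
  -- The total error is `3 / A` with `A = 4 * 2 ^ n`, which is why the scale `n + 2` is used.
  · have e : 1 / A + A * (2 * (1 / (A * A))) = 3 / A := by
      field_simp
      ring
    rw [e, hA, pow_add, one_div, inv_pow, div_lt_iff₀ (by positivity)]
    rw [← mul_assoc, inv_mul_cancel₀ (by positivity)]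
    norm_num

end CompMeas

namespace CompMeas

open Filter Topology

/-! ### Limits of admissible samples are invariant measures -/

section limit

variable {ok : ℕ → Bool} {g : ℕ → BallName × BallName} {K : ℕ}

/-- The step function on `ℝ` with the values of the sample `G` of level `r`. -/
noncomputable def stepCdf (r : ℕ) (G : ℕ → ℕ) (x : ℝ) : ℝ :=
  (G (min ⌊x * 2 ^ r⌋₊ (2 ^ r)) : ℝ) / resolution r

theorem Admissible.mono {r i j : ℕ} {G : ℕ → ℕ} (h : Admissible ok g K r G) (hij : i ≤ j)
    (hj : j ≤ 2 ^ r) : G i ≤ G j :=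
  le_of_forall_lt_le_succ (fun k hk => (h.2.2.1 k hk).1) hij hj

theorem Admissible.le_add {r i j : ℕ} {G : ℕ → ℕ} (h : Admissible ok g K r G) (hij : i ≤ j)
    (hj : j ≤ 2 ^ r) : G j ≤ G i + (j - i) * (2 * K * 2 ^ r + 1) := by
  induction j, hij using Nat.le_induction with
  | base => simp
  | succ j hij ih =>
    have h1 := ih (Nat.le_of_succ_le hj)
    have h2 := (h.2.2.1 j hj).2
    rw [Nat.succ_sub hij, Nat.succ_mul]
    omega

theorem Admissible.stepCdf_mono {r : ℕ} {G : ℕ → ℕ} (h : Admissible ok g K r G) :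
    Monotone (stepCdf r G) := fun x y hxy => by
  have h1 : ⌊x * 2 ^ r⌋₊ ≤ ⌊y * 2 ^ r⌋₊ := Nat.floor_le_floor (by gcongr)
  have h2 := h.mono (min_le_min_right (2 ^ r) h1) (min_le_right _ _)
  unfold stepCdf
  gcongr

theorem Admissible.stepCdf_mem_Icc {r : ℕ} {G : ℕ → ℕ} (h : Admissible ok g K r G) (x : ℝ) :
    stepCdf r G x ∈ Icc (0 : ℝ) 1 := by
  refine ⟨by unfold stepCdf; positivity, div_le_one_of_le₀ ?_ (Nat.cast_nonneg _)⟩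
  rw [← h.2.1]
  exact_mod_cast h.mono (min_le_right _ _) le_rfl

theorem stepCdf_coe_div {b r i : ℕ} (G : ℕ → ℕ) (hbr : b ≤ r) (hi : i ≤ 2 ^ b) :
    stepCdf r G ((i : ℝ) / 2 ^ b) = (G (i * 2 ^ (r - b)) : ℝ) / resolution r := by
  rw [stepCdf, ← coe_mul_two_pow_sub_div i hbr, div_mul_cancel₀ _ (by positivity),
    Nat.floor_natCast, min_eq_left (mul_two_pow_sub_le hbr hi)]

/-- At most `(y - x) * 2 ^ r + 1` grid steps separate the two arguments, and each obeys the tested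
increment bound. The errors vanish as `r` grows, leaving the Lipschitz constant `K`. -/
theorem Admissible.stepCdf_sub_le {r : ℕ} {G : ℕ → ℕ} (h : Admissible ok g K r G) {x y : ℝ}
    (hxy : x ≤ y) :
    stepCdf r G y - stepCdf r G x ≤ (y - x + (1 / 2) ^ r) * (K + (1 / 2) ^ r) := by
  have hM := resolution_pos r
  have hN : (0 : ℝ) < 2 ^ r := by positivity
  set i := min ⌊x * 2 ^ r⌋₊ (2 ^ r) with hi
  set j := min ⌊y * 2 ^ r⌋₊ (2 ^ r) with hj
  have h1 : ⌊x * 2 ^ r⌋₊ ≤ ⌊y * 2 ^ r⌋₊ := Nat.floor_le_floor (by gcongr)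
  have hij : i ≤ j := min_le_min_right _ h1
  have h2 : (j : ℝ) - i ≤ (y - x) * 2 ^ r + 1 := by
    have h3 : (j : ℝ) - i ≤ (⌊y * 2 ^ r⌋₊ : ℝ) - ⌊x * 2 ^ r⌋₊ := by
      have : j + ⌊x * 2 ^ r⌋₊ ≤ ⌊y * 2 ^ r⌋₊ + i := by omega
      have : (j : ℝ) + ⌊x * 2 ^ r⌋₊ ≤ ⌊y * 2 ^ r⌋₊ + i := by exact_mod_cast this
      linarith
    refine h3.trans ?_
    -- The natural number floor is 0 on negative reals, where `Nat.floor_le` is not available.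
    rcases le_or_gt y 0 with hy | hy
    · rw [Nat.floor_of_nonpos (mul_nonpos_of_nonpos_of_nonneg hy hN.le)]
      have : 0 ≤ (y - x) * 2 ^ r := mul_nonneg (sub_nonneg.2 hxy) hN.le
      have : (0 : ℝ) ≤ ⌊x * 2 ^ r⌋₊ := Nat.cast_nonneg _
      rw [Nat.cast_zero]
      linarith
    · have h4 := Nat.floor_le (mul_nonneg hy.le hN.le)
      have h5 := Nat.lt_floor_add_one (x * 2 ^ r)
      linarith
  have h6 := h.le_add hij (min_le_right _ _)
  rw [← Nat.cast_le (α := ℝ)] at h6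
  push_cast [Nat.cast_sub hij] at h6
  have h7 : ((j : ℝ) - i) * (2 * K * 2 ^ r + 1) ≤
      ((y - x) * 2 ^ r + 1) * (2 * (K * 2 ^ r + 1)) := by
    refine mul_le_mul h2 (by linarith) (by positivity) ?_
    have := sub_nonneg.2 hxy
    positivity
  rw [stepCdf, stepCdf, ← sub_div, div_le_iff₀ hM, coe_resolution]
  have e : (y - x + (1 / 2) ^ r) * (K + (1 / 2) ^ r) * (2 * (2 ^ r * 2 ^ r)) =
      ((y - x) * 2 ^ r + 1) * (2 * (K * 2 ^ r + 1)) := by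
    rw [one_div, inv_pow]
    field_simp
  rw [e]
  linarith

/-- The number of mass units is quadratic in the number of grid points so that the accumulated
rounding tolerance disappears in the limit. -/
theorem tendsto_two_pow_add_one_div_resolution :
    Tendsto (fun r => ((2 : ℝ) ^ r + 1) / resolution r) atTop (𝓝 0) := by
  have h1 : Tendsto (fun r : ℕ => ((1 : ℝ) / 2) ^ r) atTop (𝓝 0) :=
    tendsto_pow_atTop_nhds_zero_of_lt_one (by norm_num) (by norm_num)
  refine squeeze_zero (fun r => by positivity) (fun r => ?_) h1
  rw [div_le_iff₀ (resolution_pos r), coe_resolution, one_div, inv_pow]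
  have : (1 : ℝ) ≤ 2 ^ r := one_le_pow₀ one_le_two
  field_simp
  linarith

/-- Along a suitable ultrafilter, admissible samples converge to a measure with bounded density
that satisfies all tests for invariance. -/
theorem exists_limit_measure {G : ℕ → ℕ → ℕ} (hG : ∀ᶠ r in atTop, Admissible ok g K r (G r)) :
    ∃ (U : Ultrafilter ℕ) (ν : Measure I), (U : Filter ℕ) ≤ atTop ∧ IsProbabilityMeasure ν ∧
      ν ≤ (K : ℝ≥0∞) • (volume : Measure I) ∧
      ∀ b i, i ≤ 2 ^ b → Tendsto (fun r => (G r (i * 2 ^ (r - b)) : ℝ) / resolution r) U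
        (𝓝 (cdf ν ((i : ℝ) / 2 ^ b))) := by
  -- An ultrafilter gives limits at all real arguments simultaneously, without a diagonal sequence.
  set U : Ultrafilter ℕ := hyperfilter ℕ
  have hU : (U : Filter ℕ) ≤ atTop := Nat.hyperfilter_le_atTop
  have hGU : ∀ᶠ r in (U : Filter ℕ), Admissible ok g K r (G r) := hU hG
  have hlim : ∀ x : ℝ, ∃ y, Tendsto (fun r => stepCdf r (G r) x) U (𝓝 y) := fun x => by
    have hmem : Icc (0 : ℝ) 1 ∈ U.map fun r => stepCdf r (G r) x :=
      hGU.mono fun r hr => hr.stepCdf_mem_Icc x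
    obtain ⟨y, -, hy⟩ := isCompact_Icc.ultrafilter_le_nhds' _ hmem
    exact ⟨y, hy⟩
  choose F hF using hlim
  have hpow : Tendsto (fun r : ℕ => ((1 : ℝ) / 2) ^ r) U (𝓝 0) :=
    (tendsto_pow_atTop_nhds_zero_of_lt_one (by norm_num) (by norm_num)).mono_left hU
  have hdyadic : ∀ b i, i ≤ 2 ^ b → Tendsto (fun r => (G r (i * 2 ^ (r - b)) : ℝ) / resolution r) U
      (𝓝 (F ((i : ℝ) / 2 ^ b))) := fun b i hi => by
    refine (hF _).congr' ?_
    filter_upwards [hU (eventually_ge_atTop b)] with r hr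
    exact stepCdf_coe_div (G r) hr hi
  have h0 : F 0 = 0 := by
    have h := hdyadic 0 0 (Nat.zero_le _)
    simp only [Nat.cast_zero, zero_div, zero_mul] at h
    refine tendsto_nhds_unique h (tendsto_const_nhds.congr' ?_)
    filter_upwards [hGU] with r hr
    rw [hr.1]
    simp
  have h1 : F 1 = 1 := by
    have h := hdyadic 0 1 le_rfl
    simp only [Nat.cast_one, pow_zero, div_one, one_mul, Nat.sub_zero] at h
    refine tendsto_nhds_unique h (tendsto_const_nhds.congr' ?_)
    filter_upwards [hGU] with r hr
    rw [hr.2.1, div_self (resolution_pos r).ne']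
  have hmono : Monotone F := fun x y hxy =>
    le_of_tendsto_of_tendsto (hF x) (hF y) (hGU.mono fun r hr => hr.stepCdf_mono hxy)
  have hlip : ∀ x y, x ≤ y → F y - F x ≤ K * (y - x) := fun x y hxy => by
    have h2 : Tendsto (fun r : ℕ => (y - x + (1 / 2) ^ r) * ((K : ℝ) + (1 / 2) ^ r)) U
        (𝓝 ((y - x + 0) * (K + 0))) :=
      (tendsto_const_nhds.add hpow).mul (tendsto_const_nhds.add hpow)
    rw [add_zero, add_zero, mul_comm] at h2
    exact le_of_tendsto_of_tendsto ((hF y).sub (hF x)) h2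
      (hGU.mono fun r hr => hr.stepCdf_sub_le hxy)
  obtain ⟨ν, hν, hK, hcdf⟩ := exists_measure_cdf_eq hmono hlip h0 h1
  refine ⟨U, ν, hU, hν, hK, fun b i hi => ?_⟩
  rw [hcdf _ ⟨by positivity, div_le_one_of_le₀ (by exact_mod_cast hi) (by positivity)⟩]
  exact hdyadic b i hi

/-- The good cells depend on `b` but not on `r`. A fixed test therefore occurs at all large levels
as an inequality between fixed finite sums, and it passes to the limit. -/
theorem real_goodCells_le_of_tendsto {G : ℕ → ℕ → ℕ} {U : Ultrafilter ℕ} {ν : Measure I}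
    (hG : ∀ᶠ r in atTop, Admissible ok g K r (G r)) (hU : (U : Filter ℕ) ≤ atTop)
    [IsProbabilityMeasure ν] (hK : ν ≤ (K : ℝ≥0∞) • (volume : Measure I))
    (hlim : ∀ b i, i ≤ 2 ^ b → Tendsto (fun r => (G r (i * 2 ^ (r - b)) : ℝ) / resolution r) U
      (𝓝 (cdf ν ((i : ℝ) / 2 ^ b)))) {side b₀ k : ℕ} (hs : side < 2) (hk : k < 2 ^ b₀) (b : ℕ) :
    ν.real (⋃ i ∈ goodCells ok g (endBall side b₀ k) b, cell b i) ≤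
      ν.real (idealBall ratPoint (endBall side b₀ k)) := by
  rw [real_biUnion_goodCells, real_endBall hK hs hk, Finset.sum_sub_distrib]
  set τ := endBall side b₀ k
  have hsum : ∀ e ≤ 1, Tendsto (fun r => (goodSum ok g τ b r e (G r) : ℝ) / resolution r) U
      (𝓝 (∑ i ∈ goodCells ok g τ b, cdf ν (((i + e : ℕ) : ℝ) / 2 ^ b))) := fun e he => by
    simp only [goodSum_eq, Nat.cast_sum, Finset.sum_div]
    exact tendsto_finsetSum _ fun i hi => hlim b (i + e)
      ((Nat.add_le_add_left he i).trans (mem_goodCells.1 hi).1)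
  have h1 := (hsum 1 le_rfl).add (hlim b₀ _ (endLower_le (k := k) hs))
  have h2 := ((hsum 0 zero_le_one).add (hlim b₀ _ (endUpper_le hs hk))).add
    (tendsto_two_pow_add_one_div_resolution.mono_left hU)
  have h3 := le_of_tendsto_of_tendsto h1 h2 (by
    filter_upwards [hU hG, hU (eventually_gt_atTop b), hU (eventually_gt_atTop b₀)]
      with r hr hbr hb₀r
    have h := hr.2.2.2 side hs b hbr b₀ hb₀r k hk
    rw [← Nat.cast_le (α := ℝ)] at h
    push_cast at h
    rw [← add_div, ← add_div, ← add_div]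
    gcongr)
  simp only [add_zero] at h3
  linarith

/-- Once `b` exceeds the time at which a ball around `y` is listed and the cell side is below the
distance from `y` to the boundary of that ball, the cell of `y` is good. -/
theorem eventually_mem_biUnion_goodCells {τ : BallName} {y : I} (hy : y ∈ enumOpen ok g τ)
    (hy1 : y ≠ 1) : ∀ᶠ b in atTop, y ∈ ⋃ i ∈ goodCells ok g τ b, cell b i := by
  obtain ⟨t, hok, hg, hball⟩ := hy
  rw [mem_idealBall_iff] at hball
  have hpow : Tendsto (fun r : ℕ => ((1 : ℝ) / 2) ^ r) atTop (𝓝 0) :=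
    tendsto_pow_atTop_nhds_zero_of_lt_one (by norm_num) (by norm_num)
  filter_upwards [eventually_gt_atTop t, hpow.eventually_lt_const (sub_pos.2 hball)] with b hb hsmall
  obtain ⟨i, hi, hyi⟩ := exists_mem_cell b hy1
  have h1 := hyi.1
  have h2 := hyi.2
  have h3 : ((i + 1 : ℕ) : ℝ) / 2 ^ b = (i : ℝ) / 2 ^ b + (1 / 2) ^ b := by
    rw [Nat.cast_succ, add_div, one_div_pow]
  have h4 := lt_sub_comm.1 hsmall
  rw [abs_sub_lt_iff] at h4
  refine mem_iUnion₂.2 ⟨i, mem_goodCells.2 ⟨hi, t, hb, hok, hg, ?_, ?_⟩, hyi⟩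
  · rw [dyadicMem_iff, abs_sub_lt_iff]
    constructor <;> linarith
  · rw [dyadicMem_iff, abs_sub_lt_iff]
    constructor <;> linarith

theorem measure_enumOpen_le {ν : Measure I} (hK : ν ≤ (K : ℝ≥0∞) • (volume : Measure I))
    {τ : BallName} {C : ℝ≥0∞}
    (h : ∀ b, ν (⋃ i ∈ goodCells ok g τ b, cell b i) ≤ C) : ν (enumOpen ok g τ) ≤ C := by
  -- Continuity from below is applied to the increasing sets of points covered from stage `m` on; no
  -- comparison of the covers of different stages is needed.
  set V : ℕ → Set I := fun m => {y | ∀ b ≥ m, y ∈ ⋃ i ∈ goodCells ok g τ b, cell b i}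
  have hV : Monotone V := fun m n hmn y hy b hb => hy b (le_trans hmn hb)
  have hsub : enumOpen ok g τ ⊆ (⋃ m, V m) ∪ {1} := fun y hy => by
    rcases eq_or_ne y 1 with rfl | hy1
    · exact Or.inr rfl
    · obtain ⟨m, hm⟩ := eventually_atTop.1 (eventually_mem_biUnion_goodCells hy hy1)
      exact Or.inl (mem_iUnion.2 ⟨m, hm⟩)
  calc ν (enumOpen ok g τ) ≤ ν (⋃ m, V m) + ν {1} := (measure_mono hsub).trans (measure_union_le _ _)
    _ = ⨆ m, ν (V m) := by rw [measure_singleton_eq_zero hK, add_zero, hV.measure_iUnion]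
    _ ≤ C := iSup_le fun m => (measure_mono (fun y (hy : y ∈ V m) => hy m le_rfl)).trans (h m)

theorem exists_endpoint_approx {x : ℝ} (h0 : 0 ≤ x) (h1 : x < 1) (b : ℕ) :
    ∃ k < 2 ^ b, x < ((k + 1 : ℕ) : ℝ) / 2 ^ b ∧ ((k + 1 : ℕ) : ℝ) / 2 ^ b ≤ x + (1 / 2) ^ b := by
  have hB : (0 : ℝ) < 2 ^ b := by positivity
  have h2 : 0 ≤ x * 2 ^ b := by positivity
  refine ⟨⌊x * 2 ^ b⌋₊, ?_, ?_, ?_⟩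
  · rw [Nat.floor_lt h2]
    push_cast
    nlinarith
  · rw [lt_div_iff₀ hB]
    push_cast
    exact Nat.lt_floor_add_one _
  · rw [Nat.cast_succ, add_div, one_div_pow]
    gcongr
    rw [div_le_iff₀ hB]
    exact Nat.floor_le h2

/-- A measure with bounded density is invariant if preimages of balls around the endpoints are not
larger than these balls. -/
theorem measurePreserving_of_endBall {T : I → I} (hT : Measurable T) {ν : Measure I}
    [IsProbabilityMeasure ν] (hK : ν ≤ (K : ℝ≥0∞) • (volume : Measure I))
    (h : ∀ side < 2, ∀ b, ∀ k < 2 ^ b, ν.real (T ⁻¹' idealBall ratPoint (endBall side b k)) ≤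
      ν.real (idealBall ratPoint (endBall side b k))) : MeasurePreserving T ν ν := by
  have hpow : Tendsto (fun b : ℕ => (K : ℝ) * ((1 : ℝ) / 2) ^ b) atTop (𝓝 0) := by
    simpa using (tendsto_pow_atTop_nhds_zero_of_lt_one (r := (1 : ℝ) / 2) (by norm_num)
      (by norm_num)).const_mul (K : ℝ)
  have : IsProbabilityMeasure (ν.map T) := Measure.isProbabilityMeasure_map hT.aemeasurable
  refine ⟨hT, Measure.ext_of_Iic _ _ fun x => ?_⟩
  rw [Measure.map_apply hT measurableSet_Iic, ← measureReal_eq_measureReal_iff]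
  refine le_antisymm ?_ ?_
  -- Balls around 0 slightly larger than `[0, x]` bound the preimage of `Iic x` from above; `x = 1`
  -- leaves no room for a larger ball.
  · rcases eq_or_ne x 1 with rfl | hx
    · rw [show Iic (1 : I) = univ from Iic_top]
      simp
    · have hx1 : (x : ℝ) < 1 := unitInterval.coe_lt_one.2 (unitInterval.lt_one_iff_ne_one.2 hx)
      rw [real_Iic_eq_cdf hK, ← sub_nonpos]
      refine ge_of_tendsto' hpow fun b => ?_
      obtain ⟨k, hk, h1, h2⟩ := exists_endpoint_approx x.2.1 hx1 b
      have h3 : ν.real (T ⁻¹' Iic x) ≤ ν.real (T ⁻¹' idealBall ratPoint (endBall 0 b k)) :=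
        measureReal_mono fun y hy => (mem_endBall_zero b k _).2 (lt_of_le_of_lt hy h1)
      have h4 := h3.trans (h 0 two_pos b k hk)
      rw [real_endBall hK two_pos hk, show endLower 0 b k = 0 from Nat.zero_mul _,
        show endUpper 0 b k = k + 1 by simp [endUpper], Nat.cast_zero, zero_div, cdf_zero,
        sub_zero] at h4
      have h5 := cdf_sub_le hK h1.le
      have h6 : (K : ℝ) * (((k + 1 : ℕ) : ℝ) / 2 ^ b - x) ≤ K * (1 / 2) ^ b := by
        gcongr
        linarith
      linarith
  -- Balls around 1 bound the preimage of the complement from above, which is the reverse inequality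
  -- for `Iic x`.
  · rcases eq_or_ne x 0 with rfl | hx
    · rw [real_Iic_eq_cdf hK]
      simp [cdf_zero]
    · have hx0 : (0 : ℝ) < x := lt_of_le_of_ne x.2.1 fun h => hx (Subtype.ext h.symm)
      rw [real_Iic_eq_cdf hK, ← sub_nonpos]
      refine ge_of_tendsto' hpow fun b => ?_
      obtain ⟨k, hk, h1, h2⟩ := exists_endpoint_approx (sub_nonneg.2 x.2.2)
        (sub_lt_self (1 : ℝ) hx0) b
      have h3 : ν.real (T ⁻¹' (Iic x)ᶜ) ≤ ν.real (T ⁻¹' idealBall ratPoint (endBall 1 b k)) := by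
        refine measureReal_mono fun y hy => (mem_endBall_one b k _).2 ?_
        have h4 : x < T y := not_le.1 hy
        have : (x : ℝ) < T y := h4
        linarith
      have h4 := h3.trans (h 1 one_lt_two b k hk)
      have hup : endUpper 1 b k = 2 ^ b := by rw [endUpper]; omega
      have hlo : endLower 1 b k = 2 ^ b - (k + 1) := by rw [endLower]; omega
      rw [preimage_compl, probReal_compl_eq_one_sub (hT measurableSet_Iic),
        real_endBall hK one_lt_two hk, hup, hlo, coe_sub_div_two_pow hk, Nat.cast_pow,
        Nat.cast_ofNat, div_self (by positivity), cdf_one hK] at h4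
      have h5 := cdf_sub_le (a := 1 - ((k + 1 : ℕ) : ℝ) / 2 ^ b) (b := x) hK (by linarith)
      have h6 : (K : ℝ) * (x - (1 - ((k + 1 : ℕ) : ℝ) / 2 ^ b)) ≤ K * (1 / 2) ^ b := by
        gcongr
        linarith
      linarith

theorem measurePreserving_of_tendsto {T : I → I} (hTm : Measurable T)
    (hT : ∀ τ, T ⁻¹' idealBall ratPoint τ =ᵐ[volume] enumOpen ok g τ)
    {G : ℕ → ℕ → ℕ} {U : Ultrafilter ℕ} {ν : Measure I}
    (hG : ∀ᶠ r in atTop, Admissible ok g K r (G r)) (hU : (U : Filter ℕ) ≤ atTop)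
    [IsProbabilityMeasure ν] (hK : ν ≤ (K : ℝ≥0∞) • (volume : Measure I))
    (hlim : ∀ b i, i ≤ 2 ^ b → Tendsto (fun r => (G r (i * 2 ^ (r - b)) : ℝ) / resolution r) U
      (𝓝 (cdf ν ((i : ℝ) / 2 ^ b)))) : MeasurePreserving T ν ν := by
  have hac : ν ≪ volume := Measure.absolutelyContinuous_of_le_smul hK
  refine measurePreserving_of_endBall hTm hK fun side hs b₀ k hk => ?_
  rw [measureReal_congr (hac.ae_eq (hT _))]
  refine ENNReal.toReal_mono (measure_ne_top _ _) (measure_enumOpen_le hK fun b => ?_)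
  refine (ENNReal.toReal_le_toReal (measure_ne_top _ _) (measure_ne_top _ _)).1 ?_
  exact real_goodCells_le_of_tendsto hG hU hK hlim hs hk b

end limit

/-- If the invariant measure is unique, then its approximations can be certified. -/
theorem exists_certifies {ok : ℕ → Bool} {g : ℕ → BallName × BallName} {K : ℕ} {T : I → I}
    (hTm : Measurable T) (hT : ∀ τ, T ⁻¹' idealBall ratPoint τ =ᵐ[volume] enumOpen ok g τ)
    {μ : Measure I} [IsProbabilityMeasure μ] (hinv : MeasurePreserving T μ μ)
    (hK : μ ≤ (K : ℝ≥0∞) • (volume : Measure I))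
    (huniq : ∀ ν : Measure I, IsProbabilityMeasure ν → MeasurePreserving T ν ν →
      ν ≤ (K : ℝ≥0∞) • (volume : Measure I) → ν = μ) (a : ℕ) :
    ∃ r c, Certifies ok g K a r c := by
  by_contra! hno
  choose c₀ hc₀ hround using exists_sample_isRounding (ν := μ)
  -- If every admissible sample were close to the rounding of `μ`, that rounding would be certified.
  -- Levels below `a` are irrelevant and get the code 0.
  have hex : ∀ r, ∃ c, a ≤ r → Admissible ok g K r (sample r c) ∧
      ¬ SampleClose a r (sample r c) (sample r (c₀ r)) := fun r => by
    rcases le_or_gt a r with har | har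
    · by_contra! hcon
      refine hno r (c₀ r) ⟨har, (hround r).admissible hinv hK hT, fun c' _ => ?_⟩
      by_cases hadm : Admissible ok g K r (sample r c')
      · exact Or.inr ((hcon c').2 hadm)
      · exact Or.inl hadm
    · exact ⟨0, fun h => absurd h (not_le.2 har)⟩
  choose c hc using hex
  have hG : ∀ᶠ r in atTop, Admissible ok g K r (sample r (c r)) :=
    (eventually_ge_atTop a).mono fun r hr => (hc r hr).1
  obtain ⟨U, ν, hU, hν, hνK, hlim⟩ := exists_limit_measure hG
  obtain rfl : ν = μ := huniq ν hν (measurePreserving_of_tendsto hTm hT hG hU hνK hlim) hνK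
  -- One `δ` is spent on the convergence of the samples and one on the rounding of `μ`; together
  -- they are the tolerance of `SampleClose`.
  set δ : ℝ := 1 / (4 * (2 ^ a * 2 ^ a)) with hδ
  have hδ0 : 0 < δ := by positivity
  have hclose : ∀ᶠ r in (U : Filter ℕ), ∀ i ∈ Finset.range (2 ^ a + 1),
      dist ((sample r (c r) (i * 2 ^ (r - a)) : ℝ) / resolution r) (cdf ν ((i : ℝ) / 2 ^ a)) < δ :=
    (Filter.eventually_all_finset _).2 fun i hi =>
      Metric.tendsto_nhds.1 (hlim a i (Nat.lt_succ_iff.1 (Finset.mem_range.1 hi))) δ hδ0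
  have hsmall : ∀ᶠ r in (U : Filter ℕ), ((2 : ℝ) ^ r + 1) / resolution r < δ :=
    hU (tendsto_two_pow_add_one_div_resolution.eventually_lt_const hδ0)
  have hge : ∀ᶠ r in (U : Filter ℕ), a ≤ r := hU (eventually_ge_atTop a)
  obtain ⟨r, har, h1, h2⟩ := (hge.and (hclose.and hsmall)).exists
  refine (hc r har).2 fun i hi => ?_
  have hM := resolution_pos r
  have h3 := h1 i (Finset.mem_range.2 hi)
  have hi' := mul_two_pow_sub_le har (Nat.lt_succ_iff.1 hi)
  have h4 := (hround r).le hi'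
  have h5 := (hround r).lt hi'
  rw [coe_mul_two_pow_sub_div _ har] at h4 h5
  set x := sample r (c r) (i * 2 ^ (r - a))
  set y := sample r (c₀ r) (i * 2 ^ (r - a))
  rw [Real.dist_eq, abs_sub_lt_iff, sub_lt_iff_lt_add, div_lt_iff₀ hM, sub_lt_comm,
    lt_div_iff₀ hM] at h3
  rw [div_lt_iff₀ hM] at h2
  have h6 : (1 : ℝ) ≤ 2 ^ r := one_le_pow₀ one_le_two
  have h7 : (resolution r : ℝ) = δ * resolution r * (4 * (2 ^ a * 2 ^ a)) := by
    rw [hδ]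
    field_simp
  have h8 : (0 : ℝ) < 2 * (2 ^ a * 2 ^ a) := by positivity
  have h9 : (x : ℝ) ≤ y + 2 * (δ * resolution r) := by linarith [h3.1]
  have h10 : (y : ℝ) ≤ x + 2 * (δ * resolution r) := by linarith [h3.2]
  constructor
  · rw [← Nat.cast_le (α := ℝ)]
    push_cast
    rw [h7]
    linarith [mul_le_mul_of_nonneg_right h9 h8.le]
  · rw [← Nat.cast_le (α := ℝ)]
    push_cast
    rw [h7]
    linarith [mul_le_mul_of_nonneg_right h10 h8.le]

end CompMeas

theorem mainTheorem6 (T : I → I) (hT : Measurable T) (D : Set I) (hD : dimH D < 1)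
    (hcomp : CompMeas.IsComputableOn CompMeas.ratPoint CompMeas.ratPoint T Dᶜ)
    (μ : Measure I) (hμ : CompMeas.IsBoundedACIM T μ)
    (huniq : ∀ ν : Measure I, CompMeas.IsBoundedACIM T ν → ν = μ) :
    CompMeas.IsComputableMeasure CompMeas.ratPoint μ := by
  obtain ⟨V, ⟨E, hE, hV⟩, hTV⟩ := hcomp
  obtain ⟨ok, g, hok, hg, hmem⟩ := hE.exists_primrec_enum'
  obtain ⟨hprob, hinv, hdens⟩ := hμ
  obtain ⟨K, hK⟩ := CompMeas.hasBoundedDensity_iff_exists_le.1 hdens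
  have hVg : ∀ τ, V τ = CompMeas.enumOpen ok g τ := fun τ => by
    ext y
    simp only [hV, mem_iUnion, exists_prop, CompMeas.enumOpen, mem_ofPred_eq]
    constructor
    · rintro ⟨i, hi, hy⟩
      obtain ⟨t, ht, hgt⟩ := (hmem (τ, i)).1 hi
      exact ⟨t, ht, by rw [hgt], by rwa [hgt]⟩
    · rintro ⟨t, ht, hgt, hy⟩
      exact ⟨(g t).2, (hmem _).2 ⟨t, ht, by rw [← hgt]⟩, hy⟩
  have hae : ∀ τ, T ⁻¹' CompMeas.idealBall CompMeas.ratPoint τ =ᵐ[volume]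
      CompMeas.enumOpen ok g τ := fun τ => by
    -- Outside the null set `D` the preimage agrees with the enumerated open set, so invariance can
    -- be tested on the latter.
    have hD0 : ∀ᵐ y ∂(volume : Measure I), y ∉ D :=
      measure_eq_zero_iff_ae_notMem.1 (CompMeas.volume_eq_zero_of_dimH_lt_one hD)
    rw [Filter.eventuallyEq_set]
    filter_upwards [hD0] with y hy
    have h := Set.ext_iff.1 (hTV τ) y
    rw [hVg] at h
    simpa [hy] using h
  refine CompMeas.isComputableMeasure_of_certifies hok hg K
    (fun n r c h => h.W1_lt hinv hK hae)
    fun n => CompMeas.exists_certifies hT hae hinv hK (fun ν hν hνT hνK => ?_) _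
  -- Limits of samples have density at most `K`, so they fall within the class in which `μ` is
  -- unique.
  exact huniq ν ⟨hν, hνT, CompMeas.hasBoundedDensity_iff_exists_le.2 ⟨K, hνK⟩⟩
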